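/- For every choice of constants $C_I, C_{SI}, C_{SG} > 0$ there are constants $C, C', \gamma, K > 0$, depending only on $C_I, C_{SI}, C_{SG}$, such that the following holds for all integers $n \ge 1$ and $m \ge C n$. Let $P$ be a probability distribution on $\mathbb{C}^n$ such that, for $\alpha \sim P$, * $\mathbb{E}\,|\langle \alpha, z\rangle|^2 = C_I \|z\|_{\ell_2}^2$ for all $z \in \mathbb{C}^n$ (isotropy), * $\mathbb{E}\,\langle \alpha | Z | \alpha\rangle^2 \ge C_{SI} \|Z\|_2^2$ for all Hermitian $Z \in \mathbb{C}^{n\times n}$ (sub-isotropy), * $\mathbb{E}\,|\langle \alpha, z\rangle|^{2N} \le C_{SG}\, N!$ for all $z$ with $\|z\|_{\ell_2}=1$ and all integers $N \ge 1$ (sub-Gaussian tails), where $\|A\|_2 = \big(\sum_{i,j}|A_{ij}|^2\big)^{1/2}$ is the Hilbert–Schmidt norm. Let the input vectors $\alpha^{(1)},\dots,\alpha^{(m)}$ be drawn independently from $P$. Then, with probability at least $1 - K e^{-\gamma m}$ over this single draw, the following holds simultaneously for all transfer matrices $M \in \mathbb{C}^{n\times n}$ and all noise values $\epsilon_j^{(l)}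 \in \mathbb{R}$ ($1\le j\le n$, $1 \le l \le m$). Given the intensities $y_j^{(l)} = \big|\sum_i M_{ji}\alpha_i^{(l)}\big|^2 + \epsilon_j^{(l)}$, for each $j$ let $Z_j^\sharp$ be a minimizer of $\sum_{l=1}^m \big| \mathrm{tr}\big(|\alpha^{(l)}\rangle\langle\alpha^{(l)}| Z\big) - y_j^{(l)}\big|$ over all Hermitian positive semidefinite $Z \in \mathbb{C}^{n\times n}$, let $M_j^\sharp = \sqrt{\lambda_1}\, u$, where $\lambda_1$ is the largest eigenvalue of $Z_j^\sharp$ and $u$ is a corresponding unit eigenvector, and let $M^\sharp$ be the $n\times n$ matrix whose $j$-th row is the adjoint $(M_j^\sharp)^\dagger$. Such a reconstruction $M^\sharp$ exists, and if $\nu > 0$, where $\nu$ is the smallest $\ell_2$ norm of a row of $M$, then every such reconstruction (whatever the choices of minimizers and eigenvectors) satisfies $$\min_{\mu \in \mathbb{C}^n:\ |\mu_j| = 1\ \forall j} \big\| M^\sharp - \mathrm{diag}(\mu_1,\dots,\mu_n)\, M \big\|_2 \;\le\; C' \, \frac{n\, \epsilon^{\mathrm{tot}}}{m\, \nu}, \qquad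 \epsilon^{\mathrm{tot}} = \Big( \sum_{j=1}^n \Big( \sum_{l=1}^m |\epsilon_j^{(l)}| \Big)^2 \Big)^{1/2}.$$ -/

import Mathlib

open MeasureTheory
open scoped Nat ComplexOrder

noncomputable section

namespace TransferMatrix

/-! Distributions of measurement vectors in `ℂⁿ`. -/

/-- Isotropy on `ℂⁿ`: `𝔼 |⟨α, z⟩|² = C_I ‖z‖²` for every `z`. -/
def Isotropic {n : ℕ} (P : Measure (EuclideanSpace ℂ (Fin n))) (CI : ℝ) : Prop :=
  ∀ z : EuclideanSpace ℂ (Fin n), ∫ α, ‖inner ℂ α z‖ ^ 2 ∂P = CI * ‖z‖ ^ 2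

/-- The Hilbert-Schmidt (Frobenius) norm `‖A‖₂ = (tr (A A†))^(1/2)` of a complex matrix. -/
def hsNorm {n : ℕ} (A : Matrix (Fin n) (Fin n) ℂ) : ℝ :=
  Real.sqrt (∑ i, ∑ j, ‖A i j‖ ^ 2)

/-- The quadratic form `⟨α| Z |α⟩`, which is real for Hermitian `Z`. -/
def quadForm {n : ℕ} (Z : Matrix (Fin n) (Fin n) ℂ) (α : EuclideanSpace ℂ (Fin n)) : ℝ :=
  (star (α : Fin n → ℂ) ⬝ᵥ Z.mulVec (α : Fin n → ℂ)).re

/-- Sub-isotropy on Hermitian matrices: `𝔼 ⟨α| Z |α⟩² ≥ C_SI ‖Z‖₂²`. -/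
def SubIsotropic {n : ℕ} (P : Measure (EuclideanSpace ℂ (Fin n))) (CSI : ℝ) : Prop :=
  ∀ Z : Matrix (Fin n) (Fin n) ℂ, Z.IsHermitian →
    CSI * hsNorm Z ^ 2 ≤ ∫ α, quadForm Z α ^ 2 ∂P

/-- Sub-Gaussian tails: `𝔼 |⟨α, z⟩|^(2N) ≤ C_SG N!` for every unit vector `z` and `N = 1, 2, …`
(the moments being finite). -/
def SubGaussianTails {n : ℕ} (P : Measure (EuclideanSpace ℂ (Fin n))) (CSG : ℝ) : Prop :=
  ∀ z : EuclideanSpace ℂ (Fin n), ‖z‖ = 1 → ∀ N : ℕ, 1 ≤ N →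
    Integrable (fun α => ‖inner ℂ α z‖ ^ (2 * N)) P ∧
      ∫ α, ‖inner ℂ α z‖ ^ (2 * N) ∂P ≤ CSG * (N ! : ℝ)

/-! The reconstruction protocol. -/

/-- The measured intensity `y = |∑ᵢ M_{j,i} αᵢ|² + ε` at output `j` for one input vector `α`. -/
def intensity {n : ℕ} (M : Matrix (Fin n) (Fin n) ℂ) (α : EuclideanSpace ℂ (Fin n))
    (j : Fin n) (ε : ℝ) : ℝ :=
  ‖∑ i, M j i * α i‖ ^ 2 + ε

/-- The outer product `|α⟩⟨α|`. -/
def outer {n : ℕ} (α : EuclideanSpace ℂ (Fin n)) : Matrix (Fin n) (Fin n) ℂ :=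
  Matrix.vecMulVec (α : Fin n → ℂ) (star (α : Fin n → ℂ))

/-- The `ℓ₁` loss `∑ₗ |tr (|α⁽ˡ⁾⟩⟨α⁽ˡ⁾| Z) - y⁽ˡ⁾|` of PhaseLift. -/
def phaseLiftLoss {n m : ℕ} (α : Fin m → EuclideanSpace ℂ (Fin n)) (y : Fin m → ℝ)
    (Z : Matrix (Fin n) (Fin n) ℂ) : ℝ :=
  ∑ l, ‖(outer (α l) * Z).trace - (y l : ℂ)‖

/-- `Z` is a minimizer of the PhaseLift loss over the positive semidefinite Hermitian matrices. -/
def IsPhaseLiftMinimizer {n m : ℕ} (α : Fin m → EuclideanSpace ℂ (Fin n)) (y : Fin m → ℝ)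
    (Z : Matrix (Fin n) (Fin n) ℂ) : Prop :=
  Z.PosSemidef ∧
    ∀ W : Matrix (Fin n) (Fin n) ℂ, W.PosSemidef → phaseLiftLoss α y Z ≤ phaseLiftLoss α y W

/-- `x = √λ₁ u`, where `λ₁` is the largest eigenvalue of `Z` and `u` is a unit eigenvector of `Z`
for `λ₁`. -/
def IsTopEigenvector {n : ℕ} (Z : Matrix (Fin n) (Fin n) ℂ) (x : EuclideanSpace ℂ (Fin n)) :
    Prop :=
  ∃ (lam : ℝ) (u : EuclideanSpace ℂ (Fin n)),
    IsGreatest {t : ℝ | Module.End.HasEigenvalue (Matrix.toLin' Z) (t : ℂ)} lam ∧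
      ‖u‖ = 1 ∧ Z.mulVec (u : Fin n → ℂ) = (lam : ℂ) • (u : Fin n → ℂ) ∧
        x = (Real.sqrt lam : ℂ) • u

/-- `Ms` is an output of the protocol for the transfer matrix `M`, the inputs `α⁽ˡ⁾` and the noise
`ε_j⁽ˡ⁾`: its `j`-th row is the adjoint of the rescaled top eigenvector of a minimizer of PhaseLift
for the intensities measured at output `j`. -/
def IsReconstruction {n m : ℕ} (α : Fin m → EuclideanSpace ℂ (Fin n))
    (M : Matrix (Fin n) (Fin n) ℂ) (ε : Fin n → Fin m → ℝ) (Ms : Matrix (Fin n) (Fin n) ℂ) :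
    Prop :=
  ∀ j : Fin n, ∃ (Z : Matrix (Fin n) (Fin n) ℂ) (x : EuclideanSpace ℂ (Fin n)),
    IsPhaseLiftMinimizer α (fun l => intensity M (α l) j (ε j l)) Z ∧
      IsTopEigenvector Z x ∧ ∀ k, Ms j k = star (x k)

/-- The overall noise strength `ε^tot = (∑ⱼ (∑ₗ |ε_j⁽ˡ⁾|)²)^(1/2)`. -/
def totalNoise {n m : ℕ} (ε : Fin n → Fin m → ℝ) : ℝ :=
  Real.sqrt (∑ j, (∑ l, |ε j l|) ^ 2)

/-- `ν`, the smallest `ℓ₂` norm of a row of `M` (used for `n ≥ 1` only). -/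
def minRowNorm {n : ℕ} (M : Matrix (Fin n) (Fin n) ℂ) : ℝ :=
  ⨅ j : Fin n, ‖(WithLp.toLp 2 (M j) : EuclideanSpace ℂ (Fin n))‖

end TransferMatrix

end

namespace TransferMatrix

section HermitianForms

variable {n : ℕ}

theorem re_inner_mul_inner_swap (x y : EuclideanSpace ℂ (Fin n)) :
    (inner ℂ x y * inner ℂ y x).re = ‖inner ℂ x y‖ ^ 2 := by
  have h := inner_mul_symm_re_eq_norm (𝕜 := ℂ) x y
  rw [norm_mul, norm_inner_symm y x, ← sq] at h
  exact h

theorem quadForm_eq_re_inner (Z : Matrix (Fin n) (Fin n) ℂ) (x : EuclideanSpace ℂ (Fin n)) :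
    quadForm Z x = (inner ℂ x (Matrix.toEuclideanLin Z x)).re := by
  rw [EuclideanSpace.inner_eq_star_dotProduct, dotProduct_comm]
  rfl

theorem quadForm_add (Z W : Matrix (Fin n) (Fin n) ℂ) (x : EuclideanSpace ℂ (Fin n)) :
    quadForm (Z + W) x = quadForm Z x + quadForm W x := by
  simp [quadForm, Matrix.add_mulVec, dotProduct_add]

theorem quadForm_sub (Z W : Matrix (Fin n) (Fin n) ℂ) (x : EuclideanSpace ℂ (Fin n)) :
    quadForm (Z - W) x = quadForm Z x - quadForm W x := by
  simp [quadForm, Matrix.sub_mulVec, dotProduct_sub]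

theorem quadForm_smul (c : ℝ) (Z : Matrix (Fin n) (Fin n) ℂ) (x : EuclideanSpace ℂ (Fin n)) :
    quadForm (c • Z) x = c * quadForm Z x := by
  simp [quadForm, Matrix.smul_mulVec, dotProduct_smul]

theorem quadForm_outer (v x : EuclideanSpace ℂ (Fin n)) :
    quadForm (outer v) x = ‖inner ℂ x v‖ ^ 2 := by
  have h1 : inner ℂ x v = star (x : Fin n → ℂ) ⬝ᵥ (v : Fin n → ℂ) := by
    rw [EuclideanSpace.inner_eq_star_dotProduct, dotProduct_comm]
  have h2 : inner ℂ v x = star (v : Fin n → ℂ) ⬝ᵥ (x : Fin n → ℂ) := by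
    rw [EuclideanSpace.inner_eq_star_dotProduct, dotProduct_comm]
  rw [quadForm, outer, Matrix.vecMulVec_mulVec, ← h2]
  simp only [dotProduct_smul, ← h1]
  exact re_inner_mul_inner_swap x v

theorem trace_outer_mul (α : EuclideanSpace ℂ (Fin n)) (Z : Matrix (Fin n) (Fin n) ℂ) :
    (outer α * Z).trace = star (α : Fin n → ℂ) ⬝ᵥ Z.mulVec (α : Fin n → ℂ) := by
  rw [outer, Matrix.trace_mul_comm, Matrix.mul_vecMulVec, Matrix.trace_vecMulVec, dotProduct_comm]

theorem trace_outer_mul_of_isHermitian (α : EuclideanSpace ℂ (Fin n))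
    {Z : Matrix (Fin n) (Fin n) ℂ} (hZ : Z.IsHermitian) :
    (outer α * Z).trace = (quadForm Z α : ℂ) := by
  rw [trace_outer_mul]
  refine Complex.ext rfl ?_
  exact hZ.im_star_dotProduct_mulVec_self _

theorem outer_isHermitian (v : EuclideanSpace ℂ (Fin n)) : (outer v).IsHermitian := by
  rw [Matrix.IsHermitian, outer, Matrix.conjTranspose_vecMulVec, star_star]

theorem outer_posSemidef (v : EuclideanSpace ℂ (Fin n)) : (outer v).PosSemidef :=
  Matrix.posSemidef_vecMulVec_self_star _

theorem quadForm_nonneg {Z : Matrix (Fin n) (Fin n) ℂ} (hZ : Z.PosSemidef)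
    (x : EuclideanSpace ℂ (Fin n)) : 0 ≤ quadForm Z x :=
  hZ.re_dotProduct_nonneg _

theorem norm_toEuclideanLin_le (Z : Matrix (Fin n) (Fin n) ℂ) (x : EuclideanSpace ℂ (Fin n)) :
    ‖Matrix.toEuclideanLin Z x‖ ≤ hsNorm Z * ‖x‖ := by
  rw [EuclideanSpace.norm_eq, EuclideanSpace.norm_eq, hsNorm, ← Real.sqrt_mul (by positivity)]
  refine Real.sqrt_le_sqrt ?_
  rw [Finset.sum_mul]
  refine Finset.sum_le_sum fun i _ => ?_
  have h : ‖(Matrix.toEuclideanLin Z x) i‖ ≤ ∑ j, ‖Z i j‖ * ‖x j‖ := by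
    refine (norm_sum_le Finset.univ fun j => Z i j * x j).trans (le_of_eq ?_)
    exact Finset.sum_congr rfl fun j _ => norm_mul _ _
  exact (pow_le_pow_left₀ (norm_nonneg _) h 2).trans (Finset.sum_mul_sq_le_sq_mul_sq _ _ _)

theorem hsNorm_nonneg (Z : Matrix (Fin n) (Fin n) ℂ) : 0 ≤ hsNorm Z := Real.sqrt_nonneg _

theorem hsNorm_sq (Z : Matrix (Fin n) (Fin n) ℂ) : hsNorm Z ^ 2 = ∑ i, ∑ j, ‖Z i j‖ ^ 2 :=
  Real.sq_sqrt (by positivity)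

theorem norm_apply_le_hsNorm (Z : Matrix (Fin n) (Fin n) ℂ) (i j : Fin n) :
    ‖Z i j‖ ≤ hsNorm Z := by
  refine Real.le_sqrt_of_sq_le ?_
  refine le_trans ?_ (Finset.single_le_sum (f := fun i => ∑ j, ‖Z i j‖ ^ 2)
    (fun i _ => by positivity) (Finset.mem_univ i))
  exact Finset.single_le_sum (f := fun j => ‖Z i j‖ ^ 2) (fun j _ => by positivity)
    (Finset.mem_univ j)

theorem abs_quadForm_le (Z : Matrix (Fin n) (Fin n) ℂ) (x : EuclideanSpace ℂ (Fin n)) :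
    |quadForm Z x| ≤ hsNorm Z * ‖x‖ ^ 2 := by
  rw [quadForm_eq_re_inner]
  calc _ ≤ ‖inner ℂ x (Matrix.toEuclideanLin Z x)‖ := Complex.abs_re_le_norm _
    _ ≤ ‖x‖ * ‖Matrix.toEuclideanLin Z x‖ := norm_inner_le_norm _ _
    _ ≤ ‖x‖ * (hsNorm Z * ‖x‖) := by gcongr; exact norm_toEuclideanLin_le Z x
    _ = _ := by ring

variable {H : Matrix (Fin n) (Fin n) ℂ} (hH : H.IsHermitian)

theorem toEuclideanLin_eigenvectorBasis (i : Fin n) :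
    Matrix.toEuclideanLin H (hH.eigenvectorBasis i) =
      (hH.eigenvalues i : ℂ) • hH.eigenvectorBasis i := by
  ext k
  exact congrFun (hH.mulVec_eigenvectorBasis i) k

theorem inner_eigenvectorBasis_toEuclideanLin (i : Fin n) (x : EuclideanSpace ℂ (Fin n)) :
    inner ℂ (hH.eigenvectorBasis i) (Matrix.toEuclideanLin H x) =
      (hH.eigenvalues i : ℂ) * inner ℂ (hH.eigenvectorBasis i) x := by
  have h := Matrix.isSymmetric_toEuclideanLin_iff.mpr hH (hH.eigenvectorBasis i) x
  rw [← h, toEuclideanLin_eigenvectorBasis, inner_smul_left, Complex.conj_ofReal]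

theorem quadForm_eq_sum_eigenvalues (x : EuclideanSpace ℂ (Fin n)) :
    quadForm H x = ∑ i, hH.eigenvalues i * ‖inner ℂ x (hH.eigenvectorBasis i)‖ ^ 2 := by
  rw [quadForm_eq_re_inner, ← hH.eigenvectorBasis.sum_inner_mul_inner, Complex.re_sum]
  refine Finset.sum_congr rfl fun i _ => ?_
  rw [inner_eigenvectorBasis_toEuclideanLin, mul_left_comm, Complex.re_ofReal_mul]
  congr 1
  exact re_inner_mul_inner_swap _ _

theorem hsNorm_sq_eq_sum_eigenvalues : hsNorm H ^ 2 = ∑ i, hH.eigenvalues i ^ 2 := by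
  have h1 : ∀ j, ∑ i, ‖H i j‖ ^ 2 =
      ∑ i, hH.eigenvalues i ^ 2 * ‖(hH.eigenvectorBasis i) j‖ ^ 2 := by
    intro j
    have h2 : ∀ i, (Matrix.toEuclideanLin H (EuclideanSpace.single j 1)) i = H i j := by
      intro i
      simp [Matrix.toLpLin_apply]
    have h3 := hH.eigenvectorBasis.sum_sq_norm_inner_right
      (Matrix.toEuclideanLin H (EuclideanSpace.single j 1))
    rw [EuclideanSpace.norm_sq_eq] at h3
    simp only [h2] at h3
    rw [← h3]
    refine Finset.sum_congr rfl fun i _ => ?_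
    rw [inner_eigenvectorBasis_toEuclideanLin, norm_mul, mul_pow, norm_inner_symm,
      EuclideanSpace.inner_single_left]
    simp
  rw [hsNorm_sq, Finset.sum_comm]
  simp only [h1]
  rw [Finset.sum_comm]
  refine Finset.sum_congr rfl fun i _ => ?_
  rw [← Finset.mul_sum, ← EuclideanSpace.norm_sq_eq, hH.eigenvectorBasis.norm_eq_one]
  simp

theorem hsNorm_le_sum_abs_eigenvalues : hsNorm H ≤ ∑ i, |hH.eigenvalues i| := by
  refine abs_le_of_sq_le_sq' ?_ (by positivity) |>.2
  rw [hsNorm_sq_eq_sum_eigenvalues hH]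
  calc _ = ∑ i, |hH.eigenvalues i| ^ 2 := by simp
    _ ≤ _ := Finset.sum_sq_le_sq_sum_of_nonneg fun i _ => abs_nonneg _

theorem eigenvalues_eq_quadForm (i : Fin n) :
    hH.eigenvalues i = quadForm H (hH.eigenvectorBasis i) :=
  hH.eigenvalues_eq i

/-- A rank-one perturbation of a positive semidefinite matrix has at most one negative
eigenvalue. -/
theorem eq_of_eigenvalues_neg {Z : Matrix (Fin n) (Fin n) ℂ} (hZ : Z.PosSemidef)
    (x : EuclideanSpace ℂ (Fin n)) (hH : (Z - outer x).IsHermitian) {i k : Fin n}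
    (hi : hH.eigenvalues i < 0) (hk : hH.eigenvalues k < 0) : i = k := by
  by_contra hik
  set b := hH.eigenvectorBasis with hb
  set u : EuclideanSpace ℂ (Fin n) := (inner ℂ x (b k)) • b i - (inner ℂ x (b i)) • b k with hu
  have hux : inner ℂ u x = 0 := by
    rw [← inner_conj_symm, hu, inner_sub_right, inner_smul_right, inner_smul_right]
    simp [mul_comm]
  have hpos : 0 ≤ quadForm (Z - outer x) u := by
    rw [quadForm_sub, quadForm_outer, hux]
    simpa using quadForm_nonneg hZ u
  have horth : ∀ j l, inner ℂ (b j) (b l) = if j = l then (1 : ℂ) else 0 :=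
    orthonormal_iff_ite.mp b.orthonormal
  have hcoef : ∀ j, ‖inner ℂ u (b j)‖ ^ 2 =
      (if j = i then ‖inner ℂ x (b k)‖ ^ 2 else 0) +
      (if j = k then ‖inner ℂ x (b i)‖ ^ 2 else 0) := by
    intro j
    rw [norm_inner_symm, hu, inner_sub_right, inner_smul_right, inner_smul_right, horth, horth]
    by_cases hji : j = i
    · have : j ≠ k := fun h => hik (hji ▸ h)
      simp [hji, hik]
    · by_cases hjk : j = k <;> simp [hji, hjk, Ne.symm hik]
  rw [quadForm_eq_sum_eigenvalues hH, ← hb] at hpos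
  simp only [hcoef, mul_add, mul_ite, mul_zero, Finset.sum_add_distrib, Finset.sum_ite_eq',
    Finset.mem_univ, if_true] at hpos
  have h1 : inner ℂ x (b i) = 0 := by
    by_contra h
    have : 0 < ‖inner ℂ x (b i)‖ ^ 2 := by positivity
    nlinarith [sq_nonneg ‖inner ℂ x (b k)‖]
  have hpos' : 0 ≤ quadForm (Z - outer x) (b i) := by
    rw [quadForm_sub, quadForm_outer, norm_inner_symm, h1]
    simpa using quadForm_nonneg hZ (b i)
  rw [hb, ← eigenvalues_eq_quadForm hH] at hpos'
  linarith

end HermitianForms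

section Reconstruction

variable {n m : ℕ}

theorem hasEigenvalue_eigenvalues {H : Matrix (Fin n) (Fin n) ℂ} (hH : H.IsHermitian)
    (i : Fin n) : Module.End.HasEigenvalue (Matrix.toLin' H) (hH.eigenvalues i : ℂ) := by
  refine Module.End.hasEigenvalue_of_hasEigenvector
    (x := (hH.eigenvectorBasis i : Fin n → ℂ)) ⟨?_, ?_⟩
  · rw [Module.End.mem_eigenspace_iff, Matrix.toLin'_apply]
    exact hH.mulVec_eigenvectorBasis i
  · exact (WithLp.ofLp_eq_zero 2).ne.2 (hH.eigenvectorBasis.orthonormal.ne_zero i)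

theorem quadForm_le_of_eigenvalues_le {H : Matrix (Fin n) (Fin n) ℂ} (hH : H.IsHermitian)
    {lam : ℝ} (hlam : ∀ i, hH.eigenvalues i ≤ lam) (x : EuclideanSpace ℂ (Fin n)) :
    quadForm H x ≤ lam * ‖x‖ ^ 2 := by
  rw [quadForm_eq_sum_eigenvalues hH, ← hH.eigenvectorBasis.sum_sq_norm_inner_left, Finset.mul_sum]
  exact Finset.sum_le_sum fun i _ => mul_le_mul_of_nonneg_right (hlam i) (by positivity)

theorem quadForm_of_mulVec_eq {H : Matrix (Fin n) (Fin n) ℂ} {u : EuclideanSpace ℂ (Fin n)}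
    {lam : ℝ} (hu : H.mulVec (u : Fin n → ℂ) = (lam : ℂ) • (u : Fin n → ℂ)) :
    quadForm H u = lam * ‖u‖ ^ 2 := by
  have h : Matrix.toEuclideanLin H u = (lam : ℂ) • u := by
    ext k
    exact congrFun hu k
  rw [quadForm_eq_re_inner, h, inner_smul_right, Complex.re_ofReal_mul]
  congr 1
  exact inner_self_eq_norm_sq (𝕜 := ℂ) u

theorem exists_isTopEigenvector (hn : 1 ≤ n) {Z : Matrix (Fin n) (Fin n) ℂ}
    (hZ : Z.IsHermitian) : ∃ x, IsTopEigenvector Z x := by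
  have : NeZero n := ⟨by omega⟩
  obtain ⟨i, -, hi⟩ := Finset.exists_max_image (Finset.univ : Finset (Fin n)) hZ.eigenvalues
    Finset.univ_nonempty
  refine ⟨_, hZ.eigenvalues i, hZ.eigenvectorBasis i, ⟨hasEigenvalue_eigenvalues hZ i, ?_⟩,
    hZ.eigenvectorBasis.norm_eq_one i, hZ.mulVec_eigenvectorBasis i, rfl⟩
  intro t ht
  obtain ⟨v, hv⟩ := Module.End.HasEigenvalue.exists_hasEigenvector ht
  have hv1 : Z.mulVec v = (t : ℂ) • v := by
    have := hv.1
    rwa [Module.End.mem_eigenspace_iff, Matrix.toLin'_apply] at this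
  have hq := quadForm_of_mulVec_eq (u := WithLp.toLp 2 v) hv1
  have hle := quadForm_le_of_eigenvalues_le hZ (fun k => hi k (Finset.mem_univ k))
    (WithLp.toLp 2 v)
  rw [hq] at hle
  have hv0 : (WithLp.toLp 2 v : EuclideanSpace ℂ (Fin n)) ≠ 0 :=
    (WithLp.toLp_eq_zero 2).ne.2 hv.2
  exact le_of_mul_le_mul_right hle (by positivity)

/-- Perturbation of the rescaled top eigenvector of a positive semidefinite matrix close to
a rank-one matrix. -/
theorem exists_phase_norm_sub_le {Z : Matrix (Fin n) (Fin n) ℂ} (hZ : Z.PosSemidef)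
    {x y : EuclideanSpace ℂ (Fin n)} (hx : x ≠ 0) (hy : IsTopEigenvector Z y) :
    ∃ μ : ℂ, ‖μ‖ = 1 ∧ ‖y - μ • x‖ ≤ 5 * (hsNorm (Z - outer x) / ‖x‖) := by
  obtain ⟨lam, u, hlam, hu, hZu, rfl⟩ := hy
  set D := hsNorm (Z - outer x) with hD
  set r := ‖x‖ with hr
  have hr0 : 0 < r := norm_pos_iff.mpr hx
  have hD0 : 0 ≤ D := hsNorm_nonneg _
  set q := ‖inner ℂ x u‖ with hq
  set μ := Complex.exp (((inner ℂ x u).arg : ℂ) * Complex.I) with hμ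
  have hμ1 : ‖μ‖ = 1 := Complex.norm_exp_ofReal_mul_I _
  have hqμ : (q : ℂ) * μ = inner ℂ x u := Complex.norm_mul_exp_arg_mul_I _
  have hqr : q ≤ r := by simpa [hu] using norm_inner_le_norm (𝕜 := ℂ) x u
  have hq0 : 0 ≤ q := norm_nonneg _
  have hZq : quadForm Z u = lam := by rw [quadForm_of_mulVec_eq hZu, hu]; simp
  have hlam0 : 0 ≤ lam := hZq ▸ quadForm_nonneg hZ u
  have h1 : |lam - q ^ 2| ≤ D := by
    have := abs_quadForm_le (Z - outer x) u
    rwa [quadForm_sub, hZq, quadForm_outer, norm_inner_symm, hu, one_pow, mul_one] at this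
  have h2 : r ^ 2 - D ≤ lam := by
    have ha := quadForm_le_of_eigenvalues_le hZ.1
      (fun i => hlam.2 (hasEigenvalue_eigenvalues hZ.1 i)) x
    have hb := abs_quadForm_le (Z - outer x) x
    rw [quadForm_sub, quadForm_outer, inner_self_eq_norm_sq_to_K] at hb
    have hb' := (abs_le.mp hb).1
    simp only [Complex.coe_algebraMap, norm_pow, Complex.norm_real, ← hr, ← hD,
      Real.norm_of_nonneg hr0.le] at hb' ha
    have : (r ^ 2 - D) * r ^ 2 ≤ lam * r ^ 2 := by nlinarith
    exact le_of_mul_le_mul_right this (by positivity)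
  set p := Real.sqrt lam with hp
  have hp2 : p ^ 2 = lam := Real.sq_sqrt hlam0
  have hp0 : 0 ≤ p := Real.sqrt_nonneg _
  refine ⟨μ, hμ1, ?_⟩
  rw [mul_div_assoc', le_div_iff₀ hr0]
  by_cases hcase : D ≤ r ^ 2 / 2
  · have hpr : r ^ 2 / 2 ≤ p ^ 2 := by rw [hp2]; linarith
    have hp_pos : 0 < p := by
      rcases hp0.lt_or_eq with h | h
      · exact h
      · rw [← h] at hpr; nlinarith
    have he : ‖(p ^ 2 : ℂ) • u - ((q : ℂ) * μ) • x‖ ≤ D := by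
      have h3 := norm_toEuclideanLin_le (Z - outer x) u
      rw [hu, mul_one] at h3
      convert h3 using 2
      ext k
      have hk := congrFun hZu k
      have ho : (outer x).mulVec (u : Fin n → ℂ) k = inner ℂ x u * x k := by
        rw [outer, Matrix.vecMulVec_mulVec, EuclideanSpace.inner_eq_star_dotProduct,
          dotProduct_comm]
        simp [mul_comm]
      simp only [Matrix.toLpLin_apply, Matrix.sub_mulVec, PiLp.sub_apply, PiLp.smul_apply,
        Pi.sub_apply, hk, ho, hqμ, Pi.smul_apply, smul_eq_mul]
      rw [← hp2]
      push_cast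
      rfl
    have hpq : |q - p| * p ≤ D := by
      have h4 : |q - p| * (q + p) = |lam - q ^ 2| := by
        rw [← hp2, abs_sub_comm (p ^ 2), sq_sub_sq, abs_mul, abs_of_nonneg (add_nonneg hq0 hp0),
          mul_comm]
      have h5 : |q - p| * p ≤ |q - p| * (q + p) :=
        mul_le_mul_of_nonneg_left (by linarith) (abs_nonneg _)
      linarith
    have hsplit : (p : ℂ) • ((p : ℂ) • u - μ • x) =
        ((p ^ 2 : ℂ) • u - ((q : ℂ) * μ) • x) + (((q - p : ℝ) : ℂ) * μ) • x := by
      push_cast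
      module
    have hmain : p * ‖(p : ℂ) • u - μ • x‖ ≤ D + |q - p| * r := by
      calc p * ‖(p : ℂ) • u - μ • x‖ = ‖(p : ℂ) • ((p : ℂ) • u - μ • x)‖ := by
            rw [norm_smul, Complex.norm_real, Real.norm_of_nonneg hp0]
        _ ≤ D + ‖(((q - p : ℝ) : ℂ) * μ) • x‖ := by
            rw [hsplit]; exact (norm_add_le _ _).trans (by gcongr)
        _ = _ := by
            rw [norm_smul, norm_mul, hμ1, mul_one, Complex.norm_real, Real.norm_eq_abs]
    set N := ‖(p : ℂ) • u - μ • x‖ with hN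
    have hN0 : 0 ≤ N := norm_nonneg _
    have hr2p : r ≤ 3 / 2 * p := by nlinarith
    have h6 : p ^ 2 * N ≤ D * p + D * r := by nlinarith
    have h7 : p ^ 2 * (N * r) ≤ p ^ 2 * (5 * D) := by
      have : D * p + D * r ≤ 5 / 2 * (D * p) := by nlinarith
      have h8 : p ^ 2 * N * r ≤ 5 / 2 * (D * p) * r :=
        mul_le_mul_of_nonneg_right (h6.trans this) hr0.le
      have h9 : 5 / 2 * (D * p) * r ≤ 5 / 2 * (D * p) * (3 / 2 * p) :=
        mul_le_mul_of_nonneg_left hr2p (by positivity)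
      nlinarith [mul_nonneg hD0 (sq_nonneg p)]
    exact le_of_mul_le_mul_left h7 (by positivity)
  · push Not at hcase
    have h3 : ‖(p : ℂ) • u - μ • x‖ ≤ p + r := by
      refine (norm_sub_le _ _).trans (le_of_eq ?_)
      rw [norm_smul, norm_smul, hμ1, hu, Complex.norm_real, Real.norm_of_nonneg hp0]
      ring
    have h4 : p ^ 2 ≤ 3 * D := by
      rw [hp2]
      have := (abs_le.mp h1).2
      nlinarith
    have h5 : (p + r) * r ≤ 5 * D := by nlinarith [sq_nonneg (p - r)]
    exact (mul_le_mul_of_nonneg_right h3 hr0.le).trans h5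

theorem outer_zero : outer (0 : EuclideanSpace ℂ (Fin n)) = 0 := by
  ext i j
  simp [outer, Matrix.vecMulVec_apply]

theorem continuous_quadForm (x : EuclideanSpace ℂ (Fin n)) :
    Continuous fun Z : Matrix (Fin n) (Fin n) ℂ => quadForm Z x := by
  unfold quadForm
  exact Complex.continuous_re.comp
    (continuous_const.dotProduct (continuous_id.matrix_mulVec continuous_const))

theorem continuous_hsNorm : Continuous (hsNorm : Matrix (Fin n) (Fin n) ℂ → ℝ) := by
  unfold hsNorm
  refine Real.continuous_sqrt.comp ?_
  refine continuous_finsetSum _ fun i _ => continuous_finsetSum _ fun j _ => ?_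
  exact ((continuous_id.matrix_elem i j).norm).pow 2

theorem posSemidef_iff_quadForm {Z : Matrix (Fin n) (Fin n) ℂ} :
    Z.PosSemidef ↔ Z.IsHermitian ∧ ∀ x, 0 ≤ quadForm Z x := by
  refine ⟨fun h => ⟨h.1, quadForm_nonneg h⟩, fun h =>
    Matrix.PosSemidef.of_dotProduct_mulVec_nonneg h.1 fun x => ?_⟩
  have h1 := h.2 (WithLp.toLp 2 x)
  rw [Complex.le_def]
  exact ⟨h1, (h.1.im_star_dotProduct_mulVec_self x).symm⟩

theorem isClosed_posSemidef : IsClosed {Z : Matrix (Fin n) (Fin n) ℂ | Z.PosSemidef} := by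
  simp only [posSemidef_iff_quadForm, Set.ofPred_and, Set.ofPred_forall]
  refine IsClosed.inter ?_ (isClosed_iInter fun x =>
    isClosed_le continuous_const (continuous_quadForm x))
  exact isClosed_eq continuous_id.matrix_conjTranspose continuous_id

theorem isCompact_posSemidef_hsNorm_le (R : ℝ) :
    IsCompact {Z : Matrix (Fin n) (Fin n) ℂ | Z.PosSemidef ∧ hsNorm Z ≤ R} := by
  have hK : IsCompact (Set.univ.pi fun _ : Fin n => Set.univ.pi fun _ : Fin n =>
      Metric.closedBall (0 : ℂ) R) :=
    isCompact_univ_pi fun _ => isCompact_univ_pi fun _ => isCompact_closedBall _ _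
  refine hK.of_isClosed_subset
    (isClosed_posSemidef.inter (isClosed_le continuous_hsNorm continuous_const)) ?_
  rintro Z ⟨-, hZ⟩ i - j -
  simpa using (norm_apply_le_hsNorm Z i j).trans hZ

theorem continuous_phaseLiftLoss (α : Fin m → EuclideanSpace ℂ (Fin n)) (y : Fin m → ℝ) :
    Continuous (phaseLiftLoss α y) := by
  unfold phaseLiftLoss
  refine continuous_finsetSum _ fun l _ => ?_
  exact ((continuous_const.matrix_mul continuous_id).matrix_trace.sub continuous_const).norm

theorem phaseLiftLoss_eq (α : Fin m → EuclideanSpace ℂ (Fin n)) (y : Fin m → ℝ)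
    {Z : Matrix (Fin n) (Fin n) ℂ} (hZ : Z.IsHermitian) :
    phaseLiftLoss α y Z = ∑ l, |quadForm Z (α l) - y l| := by
  refine Finset.sum_congr rfl fun l _ => ?_
  rw [trace_outer_mul_of_isHermitian _ hZ, ← Complex.ofReal_sub, Complex.norm_real,
    Real.norm_eq_abs]

/-- Lower isometry-type bound for the measurement map on differences of positive semidefinite
and rank-one matrices. -/
def SeparatesRankOne (α : Fin m → EuclideanSpace ℂ (Fin n)) (c : ℝ) : Prop :=
  ∀ (Z : Matrix (Fin n) (Fin n) ℂ) (x : EuclideanSpace ℂ (Fin n)), Z.PosSemidef →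
    c * hsNorm (Z - outer x) ≤ ∑ l, |quadForm (Z - outer x) (α l)|

theorem SeparatesRankOne.exists_isPhaseLiftMinimizer {α : Fin m → EuclideanSpace ℂ (Fin n)}
    {c : ℝ} (hα : SeparatesRankOne α c) (hc : 0 < c) (y : Fin m → ℝ) :
    ∃ Z, IsPhaseLiftMinimizer α y Z := by
  set S := ∑ l, |y l| with hS
  have hS0 : 0 ≤ S := Finset.sum_nonneg fun l _ => abs_nonneg _
  have hz : phaseLiftLoss α y 0 = S := by
    simp [phaseLiftLoss, hS]
  have h0mem : (0 : Matrix (Fin n) (Fin n) ℂ).PosSemidef ∧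
      hsNorm (0 : Matrix (Fin n) (Fin n) ℂ) ≤ 2 * S / c :=
    ⟨Matrix.PosSemidef.zero, by simp [hsNorm]; positivity⟩
  obtain ⟨Z, hZ, hmin⟩ := (isCompact_posSemidef_hsNorm_le (n := n) (2 * S / c)).exists_isMinOn
    ⟨0, h0mem⟩ (continuous_phaseLiftLoss α y).continuousOn
  refine ⟨Z, hZ.1, fun W hW => ?_⟩
  by_cases hWR : hsNorm W ≤ 2 * S / c
  · exact hmin ⟨hW, hWR⟩
  · push Not at hWR
    have h1 : phaseLiftLoss α y Z ≤ S := hz ▸ hmin h0mem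
    have h2 := hα W 0 hW
    rw [outer_zero, sub_zero] at h2
    rw [div_lt_iff₀ hc] at hWR
    have h3 : ∑ l, |quadForm W (α l)| ≤ phaseLiftLoss α y W + S := by
      rw [phaseLiftLoss_eq _ _ hW.1, hS, ← Finset.sum_add_distrib]
      refine Finset.sum_le_sum fun l _ => ?_
      simpa using abs_add_le (quadForm W (α l) - y l) (y l)
    linarith

theorem SeparatesRankOne.hsNorm_sub_le {α : Fin m → EuclideanSpace ℂ (Fin n)}
    {c : ℝ} (hα : SeparatesRankOne α c) (hc : 0 < c) (x : EuclideanSpace ℂ (Fin n))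
    (ε : Fin m → ℝ) {Z : Matrix (Fin n) (Fin n) ℂ}
    (hZ : IsPhaseLiftMinimizer α (fun l => quadForm (outer x) (α l) + ε l) Z) :
    hsNorm (Z - outer x) ≤ 2 / c * ∑ l, |ε l| := by
  have h1 := hZ.2 _ (outer_posSemidef x)
  rw [phaseLiftLoss_eq _ _ hZ.1.1, phaseLiftLoss_eq _ _ (outer_isHermitian x)] at h1
  simp only [sub_add_cancel_left, abs_neg] at h1
  have h2 := hα Z x hZ.1
  have h3 : ∑ l, |quadForm (Z - outer x) (α l)| ≤
      ∑ l, |quadForm Z (α l) - (quadForm (outer x) (α l) + ε l)| + ∑ l, |ε l| := by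
    rw [← Finset.sum_add_distrib]
    refine Finset.sum_le_sum fun l _ => ?_
    rw [quadForm_sub]
    refine le_trans (le_of_eq ?_) (abs_add_le _ _)
    congr 1; ring
  rw [div_mul_eq_mul_div, le_div_iff₀ hc]
  linarith

theorem intensity_eq (M : Matrix (Fin n) (Fin n) ℂ) (α : EuclideanSpace ℂ (Fin n)) (j : Fin n)
    (ε : ℝ) : intensity M α j ε = quadForm (outer (WithLp.toLp 2 (star (M j)))) α + ε := by
  rw [intensity, quadForm_outer, norm_inner_symm, EuclideanSpace.inner_eq_star_dotProduct,
    dotProduct_comm]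
  simp [dotProduct]

theorem SeparatesRankOne.exists_isReconstruction {α : Fin m → EuclideanSpace ℂ (Fin n)}
    {c : ℝ} (hα : SeparatesRankOne α c) (hc : 0 < c) (hn : 1 ≤ n)
    (M : Matrix (Fin n) (Fin n) ℂ) (ε : Fin n → Fin m → ℝ) :
    ∃ Ms, IsReconstruction α M ε Ms := by
  choose Z hZ using fun j => hα.exists_isPhaseLiftMinimizer hc
    (fun l => intensity M (α l) j (ε j l))
  choose x hx using fun j => exists_isTopEigenvector hn (hZ j).1.1
  exact ⟨fun j k => star (x j k), fun j => ⟨Z j, x j, hZ j, hx j, fun _ => rfl⟩⟩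

theorem SeparatesRankOne.hsNorm_reconstruction_sub_le {α : Fin m → EuclideanSpace ℂ (Fin n)}
    {c : ℝ} (hα : SeparatesRankOne α c) (hc : 0 < c)
    {M Ms : Matrix (Fin n) (Fin n) ℂ} {ε : Fin n → Fin m → ℝ} (hM : 0 < minRowNorm M)
    (hMs : IsReconstruction α M ε Ms) :
    ∃ μ : Fin n → ℂ, (∀ j, ‖μ j‖ = 1) ∧
      hsNorm (Ms - Matrix.diagonal μ * M) ≤ 10 / c * (totalNoise ε / minRowNorm M) := by
  set ν := minRowNorm M with hν
  have hrow : ∀ j, ν ≤ ‖(WithLp.toLp 2 (star (M j)) : EuclideanSpace ℂ (Fin n))‖ := by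
    intro j
    refine (ciInf_le ⟨0, ?_⟩ j).trans (le_of_eq ?_)
    · rintro _ ⟨j, rfl⟩
      exact norm_nonneg _
    · simp [EuclideanSpace.norm_eq]
  have key : ∀ j, ∃ μ : ℂ, ‖μ‖ = 1 ∧
      ∑ k, ‖Ms j k - μ * M j k‖ ^ 2 ≤ (10 / c * (∑ l, |ε j l|) / ν) ^ 2 := by
    intro j
    obtain ⟨Z, y, hZ, hy, hyj⟩ := hMs j
    simp only [intensity_eq] at hZ
    set x : EuclideanSpace ℂ (Fin n) := WithLp.toLp 2 (star (M j)) with hx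
    have hx0 : x ≠ 0 := norm_pos_iff.mp (hM.trans_le (hrow j))
    obtain ⟨μ, hμ, hle⟩ := exists_phase_norm_sub_le hZ.1 hx0 hy
    refine ⟨star μ, by simpa using hμ, ?_⟩
    have h1 : ∑ k, ‖Ms j k - star μ * M j k‖ ^ 2 = ‖y - μ • x‖ ^ 2 := by
      rw [EuclideanSpace.norm_sq_eq]
      refine Finset.sum_congr rfl fun k _ => ?_
      rw [hyj, ← norm_star (_ - _)]
      simp [hx]
    rw [h1]
    refine pow_le_pow_left₀ (norm_nonneg _) (hle.trans ?_) 2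
    have h2 := hα.hsNorm_sub_le hc x (ε j) hZ
    calc 5 * (hsNorm (Z - outer x) / ‖x‖) ≤ 5 * ((2 / c * ∑ l, |ε j l|) / ν) := by
          gcongr
          exact hrow j
      _ = _ := by ring
  choose μ hμ hle using key
  refine ⟨μ, hμ, ?_⟩
  have h3 : 0 ≤ 10 / c * (totalNoise ε / ν) := by
    have : 0 ≤ totalNoise ε := Real.sqrt_nonneg _
    positivity
  refine Real.sqrt_le_iff.mpr ⟨h3, ?_⟩
  calc _ ≤ ∑ j, (10 / c * (∑ l, |ε j l|) / ν) ^ 2 := by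
        refine Finset.sum_le_sum fun j _ => ?_
        simpa [Matrix.diagonal_mul] using hle j
    _ = (10 / c * (totalNoise ε / ν)) ^ 2 := by
        rw [mul_pow, div_pow (totalNoise ε), totalNoise,
          Real.sq_sqrt (Finset.sum_nonneg fun j _ => sq_nonneg _), Finset.sum_div, Finset.mul_sum]
        refine Finset.sum_congr rfl fun j _ => ?_
        ring

end Reconstruction

section Nets

open Metric Module in
theorem card_le_of_separated_unitBall {E : Type*} [NormedAddCommGroup E] [NormedSpace ℝ E]
    [FiniteDimensional ℝ E] (s : Finset E) (hs : ∀ c ∈ s, ‖c‖ ≤ 1)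
    (h : ∀ c ∈ s, ∀ d ∈ s, c ≠ d → 1 / 4 ≤ ‖c - d‖) : s.card ≤ 9 ^ finrank ℝ E := by
  borelize E
  let μ : Measure E := Measure.addHaar
  have hδ : (0 : ℝ) < 1 / 8 := by norm_num
  have hρ : (0 : ℝ) < 9 / 8 := by norm_num
  have hdisj : (s : Set E).PairwiseDisjoint fun c => ball c (1 / 8 : ℝ) := by
    rintro c hc d hd hcd
    apply ball_disjoint_ball
    rw [dist_eq_norm]
    linarith [h c hc d hd hcd]
  have hsub : (⋃ c ∈ s, ball c (1 / 8 : ℝ)) ⊆ ball (0 : E) (9 / 8) := by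
    refine Set.iUnion₂_subset fun x hx => ball_subset_ball' ?_
    rw [dist_zero_right]
    linarith [hs x hx]
  have I : (s.card : ENNReal) * ENNReal.ofReal ((1 / 8) ^ finrank ℝ E) * μ (ball 0 1) ≤
      ENNReal.ofReal ((9 / 8) ^ finrank ℝ E) * μ (ball 0 1) := by
    have h1 := measure_mono (μ := μ) hsub
    rw [measure_biUnion_finset hdisj fun c _ => measurableSet_ball] at h1
    simpa only [μ.addHaar_ball_of_pos _ hδ, μ.addHaar_ball_of_pos _ hρ, Finset.sum_const,
      nsmul_eq_mul, mul_assoc] using h1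
  have J := (ENNReal.mul_le_mul_iff_left (measure_ball_pos μ (0 : E) zero_lt_one).ne'
    measure_ball_lt_top.ne).1 I
  have K : (s.card : ℝ) ≤ (9 : ℝ) ^ finrank ℝ E := by
    have := ENNReal.toReal_le_of_le_ofReal (pow_nonneg hρ.le _) J
    simpa [div_eq_mul_inv, mul_pow] using this
  exact mod_cast K

theorem exists_net_unitBall (E : Type*) [NormedAddCommGroup E] [NormedSpace ℝ E]
    [FiniteDimensional ℝ E] : ∃ N : Finset E, (∀ v ∈ N, ‖v‖ ≤ 1) ∧
      (∀ x : E, ‖x‖ ≤ 1 → ∃ v ∈ N, ‖x - v‖ ≤ 1 / 4) ∧ N.card ≤ 9 ^ Module.finrank ℝ E := by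
  classical
  let p : ℕ → Prop := fun k => ∃ s : Finset E, (∀ c ∈ s, ‖c‖ ≤ 1) ∧
    (∀ c ∈ s, ∀ d ∈ s, c ≠ d → 1 / 4 ≤ ‖c - d‖) ∧ s.card = k
  have hbound : ∀ k, p k → k ≤ 9 ^ Module.finrank ℝ E := by
    rintro k ⟨s, h1, h2, rfl⟩
    exact card_le_of_separated_unitBall s h1 h2
  obtain ⟨N, hN1, hN2, hN3⟩ : p (Nat.findGreatest p (9 ^ Module.finrank ℝ E)) :=
    Nat.findGreatest_spec (Nat.zero_le _) ⟨∅, by simp, by simp, rfl⟩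
  refine ⟨N, hN1, fun x hx => ?_, hN3 ▸ Nat.findGreatest_le _⟩
  by_contra! hcon
  have hxN : x ∉ N := fun hmem => by
    have := hcon x hmem
    simp at this
    linarith
  have hp : p (N.card + 1) := by
    refine ⟨insert x N, ?_, ?_, Finset.card_insert_of_notMem hxN⟩
    · simpa using ⟨hx, hN1⟩
    · intro c hc d hd hcd
      rcases Finset.mem_insert.mp hc with hcx | hc <;>
        rcases Finset.mem_insert.mp hd with hdx | hd
      · exact absurd (hcx.trans hdx.symm) hcd
      · rw [hcx]; exact (hcon d hd).le
      · rw [hdx, norm_sub_rev]; exact (hcon c hc).le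
      · exact hN2 c hc d hd hcd
  have := Nat.le_findGreatest (hbound _ hp) hp
  omega

/-- A `1/4`-net of the unit ball, contained in the unit ball. -/
def IsUnitBallNet {E : Type*} [NormedAddCommGroup E] (N : Finset E) : Prop :=
  (∀ v ∈ N, ‖v‖ ≤ 1) ∧ ∀ x : E, ‖x‖ ≤ 1 → ∃ v ∈ N, ‖x - v‖ ≤ 1 / 4

theorem exists_isUnitBallNet (n : ℕ) :
    ∃ N : Finset (EuclideanSpace ℂ (Fin n)), IsUnitBallNet N ∧ N.card ≤ 81 ^ n := by
  obtain ⟨N, h1, h2, h3⟩ := exists_net_unitBall (EuclideanSpace ℂ (Fin n))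
  refine ⟨N, ⟨h1, h2⟩, h3.trans (le_of_eq ?_)⟩
  rw [finrank_real_of_complex, finrank_euclideanSpace_fin, pow_mul]
  norm_num

theorem norm_sq_sub_norm_sq {E : Type*} [NormedAddCommGroup E] [InnerProductSpace ℂ E] (a b : E) :
    ‖a‖ ^ 2 - ‖b‖ ^ 2 = (‖(3 : ℂ) • (a - b) + (1 / 3 : ℂ) • (a + b)‖ ^ 2 -
      ‖(3 : ℂ) • (a - b) - (1 / 3 : ℂ) • (a + b)‖ ^ 2) / 4 := by
  have h1 : RCLike.re (inner ℂ ((3 : ℂ) • (a - b)) ((1 / 3 : ℂ) • (a + b))) =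
      ‖a‖ ^ 2 - ‖b‖ ^ 2 := by
    have h2 : inner ℂ ((3 : ℂ) • (a - b)) ((1 / 3 : ℂ) • (a + b)) = inner ℂ (a - b) (a + b) := by
      rw [inner_smul_left, inner_smul_right, ← mul_assoc]
      have : (starRingEnd ℂ) 3 * (1 / 3) = 1 := by
        rw [Complex.conj_ofNat]; norm_num
      rw [this, one_mul]
    rw [h2, inner_sub_left, inner_add_right, inner_add_right, ← inner_self_eq_norm_sq (𝕜 := ℂ) a,
      ← inner_self_eq_norm_sq (𝕜 := ℂ) b]
    simp only [map_sub, map_add]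
    rw [inner_re_symm (𝕜 := ℂ) b a]
    ring
  rw [@norm_add_sq ℂ, @norm_sub_sq ℂ, h1]
  ring

/-- A quadratic form that is small on a net is small on the unit ball. -/
theorem IsUnitBallNet.abs_apply_le {E : Type*} [NormedAddCommGroup E] [InnerProductSpace ℂ E]
    {N : Finset E} (hN : IsUnitBallNet N) {q : E → ℝ} {K η : ℝ}
    (hK : ∀ u, |q u| ≤ K * ‖u‖ ^ 2) (hhom : ∀ (c : ℝ) u, q ((c : ℂ) • u) = c ^ 2 * q u)
    (hpol : ∀ a b, q a - q b = (q ((3 : ℂ) • (a - b) + (1 / 3 : ℂ) • (a + b)) -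
      q ((3 : ℂ) • (a - b) - (1 / 3 : ℂ) • (a + b))) / 4)
    (hη : ∀ v ∈ N, |q v| ≤ η) {u : E} (hu : ‖u‖ ≤ 1) : |q u| ≤ 3 * η := by
  set S := (fun u => |q u|) '' {u | ‖u‖ ≤ 1} with hS
  have hSbdd : BddAbove S := by
    refine ⟨|K|, ?_⟩
    rintro _ ⟨w, hw, rfl⟩
    refine (hK w).trans ?_
    have h1 : ‖w‖ ^ 2 ≤ 1 := pow_le_one₀ (norm_nonneg _) hw
    nlinarith [le_abs_self K, abs_nonneg K, sq_nonneg ‖w‖]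
  set κ := sSup S with hκ
  have hball : ∀ w, ‖w‖ ≤ 1 → |q w| ≤ κ := fun w hw => le_csSup hSbdd ⟨w, hw, rfl⟩
  have hq0 : q 0 = 0 := by simpa using hhom 0 0
  have hκ0 : 0 ≤ κ := (abs_nonneg (q 0)).trans (hball 0 (by simp))
  have hall : ∀ w, |q w| ≤ κ * ‖w‖ ^ 2 := by
    intro w
    rcases eq_or_ne w 0 with rfl | hw
    · simp [hq0]
    · have hw0 : 0 < ‖w‖ := norm_pos_iff.mpr hw
      have h1 := hball (((‖w‖⁻¹ : ℝ) : ℂ) • w) (by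
        rw [norm_smul, Complex.norm_real, norm_inv, norm_norm, inv_mul_cancel₀ hw0.ne'])
      rw [hhom, abs_mul, abs_of_nonneg (by positivity), inv_pow, inv_mul_le_iff₀ (by positivity)]
        at h1
      linarith
  have hstep : ∀ w, ‖w‖ ≤ 1 → |q w| ≤ η + 145 / 288 * κ := by
    intro w hw
    obtain ⟨v, hv, hwv⟩ := hN.2 w hw
    set p := (3 : ℂ) • (w - v) with hp
    set r := (1 / 3 : ℂ) • (w + v) with hr
    have hpn : ‖p‖ ≤ 3 / 4 := by
      rw [hp, norm_smul, Complex.norm_ofNat]; linarith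
    have hrn : ‖r‖ ≤ 2 / 3 := by
      rw [hr, norm_smul]
      have h1 : ‖w + v‖ ≤ 2 := (norm_add_le _ _).trans (by linarith [hN.1 v hv])
      have h2 : ‖(1 / 3 : ℂ)‖ = 1 / 3 := by norm_num
      rw [h2]; linarith
    have hpar := parallelogram_law_with_norm ℂ p r
    have h1 := hall (p + r)
    have h2 := hall (p - r)
    have h3 := abs_le.mp (hη v hv)
    have h4 := hpol w v
    have h5 : ‖p + r‖ ^ 2 + ‖p - r‖ ^ 2 ≤ 145 / 72 := by
      nlinarith [norm_nonneg p, norm_nonneg r]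
    have h6 : κ * ‖p + r‖ ^ 2 + κ * ‖p - r‖ ^ 2 ≤ κ * (145 / 72) := by
      rw [← mul_add]; exact mul_le_mul_of_nonneg_left h5 hκ0
    rw [abs_le] at h1 h2 ⊢
    constructor <;> linarith [h1.1, h1.2, h2.1, h2.2, h3.1, h3.2]
  have hκle : κ ≤ η + 145 / 288 * κ := by
    refine csSup_le ⟨_, ⟨0, by simp, rfl⟩⟩ ?_
    rintro _ ⟨w, hw, rfl⟩
    exact hstep w hw
  have := hball u hu
  nlinarith

end Nets

section Certificates

variable {n m : ℕ}

/-- The quadratic form of `m⁻¹ ∑ₗ tₗ |αₗ⟩⟨αₗ| - (1 - 2 |v⟩⟨v|)`. -/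
noncomputable def certificateForm (α : Fin m → EuclideanSpace ℂ (Fin n)) (t : Fin m → ℝ)
    (v u : EuclideanSpace ℂ (Fin n)) : ℝ :=
  (m : ℝ)⁻¹ * ∑ l, t l * ‖inner ℂ (α l) u‖ ^ 2 - (‖u‖ ^ 2 - 2 * ‖inner ℂ v u‖ ^ 2)

theorem IsUnitBallNet.abs_certificateForm_le {N : Finset (EuclideanSpace ℂ (Fin n))}
    (hN : IsUnitBallNet N) {α : Fin m → EuclideanSpace ℂ (Fin n)} {t : Fin m → ℝ}
    {v : EuclideanSpace ℂ (Fin n)} {η : ℝ} (hη : ∀ u ∈ N, |certificateForm α t v u| ≤ η)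
    {u : EuclideanSpace ℂ (Fin n)} (hu : ‖u‖ ≤ 1) : |certificateForm α t v u| ≤ 3 * η := by
  refine hN.abs_apply_le (K := (m : ℝ)⁻¹ * ∑ l, |t l| * ‖α l‖ ^ 2 + (1 + 2 * ‖v‖ ^ 2))
    ?_ ?_ ?_ hη hu
  · intro u
    have hi : ∀ w : EuclideanSpace ℂ (Fin n), ‖inner ℂ w u‖ ^ 2 ≤ ‖w‖ ^ 2 * ‖u‖ ^ 2 := fun w => by
      rw [← mul_pow]; exact pow_le_pow_left₀ (norm_nonneg _) (norm_inner_le_norm _ _) 2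
    have h1 : |(m : ℝ)⁻¹ * ∑ l, t l * ‖inner ℂ (α l) u‖ ^ 2| ≤
        (m : ℝ)⁻¹ * (∑ l, |t l| * ‖α l‖ ^ 2) * ‖u‖ ^ 2 := by
      rw [abs_mul, abs_of_nonneg (by positivity : (0 : ℝ) ≤ (m : ℝ)⁻¹), mul_assoc, Finset.sum_mul]
      gcongr
      refine (Finset.abs_sum_le_sum_abs _ _).trans (Finset.sum_le_sum fun l _ => ?_)
      rw [abs_mul, abs_of_nonneg (by positivity : (0 : ℝ) ≤ ‖inner ℂ (α l) u‖ ^ 2), mul_assoc]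
      exact mul_le_mul_of_nonneg_left (hi _) (abs_nonneg _)
    have h2 : |‖u‖ ^ 2 - 2 * ‖inner ℂ v u‖ ^ 2| ≤ (1 + 2 * ‖v‖ ^ 2) * ‖u‖ ^ 2 := by
      have := hi v
      rw [abs_le]
      constructor <;> nlinarith [sq_nonneg ‖u‖, sq_nonneg ‖inner ℂ v u‖, sq_nonneg ‖v‖]
    refine (abs_sub _ _).trans ?_
    rw [add_mul]
    exact add_le_add h1 h2
  · intro c u
    simp only [certificateForm, inner_smul_right, norm_smul, norm_mul, Complex.norm_real, mul_pow,
      Real.norm_eq_abs, sq_abs]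
    have : ∑ l, t l * (c ^ 2 * ‖inner ℂ (α l) u‖ ^ 2) =
        c ^ 2 * ∑ l, t l * ‖inner ℂ (α l) u‖ ^ 2 := by
      rw [Finset.mul_sum]
      exact Finset.sum_congr rfl fun l _ => by ring
    rw [this]; ring
  · intro a b
    have hi : ∀ w : EuclideanSpace ℂ (Fin n), ‖inner ℂ w a‖ ^ 2 - ‖inner ℂ w b‖ ^ 2 =
        (‖inner ℂ w ((3 : ℂ) • (a - b) + (1 / 3 : ℂ) • (a + b))‖ ^ 2 -
          ‖inner ℂ w ((3 : ℂ) • (a - b) - (1 / 3 : ℂ) • (a + b))‖ ^ 2) / 4 := fun w => by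
      rw [norm_sq_sub_norm_sq (inner ℂ w a) (inner ℂ w b)]
      simp only [inner_add_right, inner_sub_right, inner_smul_right, smul_eq_mul]
    have hsum : ∑ l, t l * ‖inner ℂ (α l) a‖ ^ 2 - ∑ l, t l * ‖inner ℂ (α l) b‖ ^ 2 =
        (∑ l, t l * ‖inner ℂ (α l) ((3 : ℂ) • (a - b) + (1 / 3 : ℂ) • (a + b))‖ ^ 2 -
        ∑ l, t l * ‖inner ℂ (α l) ((3 : ℂ) • (a - b) - (1 / 3 : ℂ) • (a + b))‖ ^ 2) / 4 := by
      rw [← Finset.sum_sub_distrib, ← Finset.sum_sub_distrib, Finset.sum_div]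
      refine Finset.sum_congr rfl fun l _ => ?_
      rw [← mul_sub, hi]; ring
    unfold certificateForm
    linear_combination (m : ℝ)⁻¹ * hsum - norm_sq_sub_norm_sq a b + 2 * hi v

theorem separatesRankOne_of_certificateForm_le {N : Finset (EuclideanSpace ℂ (Fin n))}
    (hN : IsUnitBallNet N) {α : Fin m → EuclideanSpace ℂ (Fin n)}
    {t : EuclideanSpace ℂ (Fin n) → Fin m → ℝ} {B : ℝ} (hB : 0 < B) (hm : 0 < m)
    (ht : ∀ v ∈ N, ∀ l, |t v l| ≤ B)
    (hq : ∀ v ∈ N, ∀ u ∈ N, |certificateForm α (t v) v u| ≤ 1 / 64) :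
    SeparatesRankOne α (m / (16 * B)) := by
  intro Z x hZ
  have hH : (Z - outer x).IsHermitian := hZ.1.sub (outer_isHermitian x)
  set H := Z - outer x with hHdef
  set b := hH.eigenvectorBasis with hb
  set e := hH.eigenvalues with he
  have hm0 : (0 : ℝ) < m := by exact_mod_cast hm
  obtain ⟨v, hv1, hpos, hneg⟩ : ∃ v : EuclideanSpace ℂ (Fin n), ‖v‖ ≤ 1 ∧
      (∀ i, 0 ≤ e i → inner ℂ v (b i) = 0) ∧ (∀ i, e i < 0 → v = b i) := by
    by_cases hex : ∃ k, e k < 0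
    · obtain ⟨k, hk⟩ := hex
      refine ⟨b k, (b.norm_eq_one k).le, fun i hi => ?_, fun i hi => ?_⟩
      · have hki : k ≠ i := by rintro rfl; linarith
        exact b.inner_eq_zero hki
      · rw [eq_of_eigenvalues_neg hZ x hH hk hi]
    · push Not at hex
      exact ⟨0, by simp, fun i _ => by simp, fun i hi => absurd hi (hex i).not_gt⟩
  obtain ⟨w, hw, hvw⟩ := hN.2 v hv1
  set y : Fin n → ℝ := fun i => (m : ℝ)⁻¹ * ∑ l, t w l * ‖inner ℂ (α l) (b i)‖ ^ 2 with hy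
  have hyi : ∀ i, |y i - (1 - 2 * ‖inner ℂ w (b i)‖ ^ 2)| ≤ 3 / 64 := by
    intro i
    have h := hN.abs_certificateForm_le (hq w hw) (b.norm_eq_one i).le
    rw [certificateForm, b.norm_eq_one, one_pow] at h
    exact h.trans (by norm_num)
  have hdiff : ∀ i, ‖inner ℂ w (b i) - inner ℂ v (b i)‖ ≤ 1 / 4 := by
    intro i
    rw [← inner_sub_left]
    refine (norm_inner_le_norm _ _).trans ?_
    rw [b.norm_eq_one, mul_one, norm_sub_rev]
    exact hvw
  have hterm : ∀ i, |e i| / 16 ≤ e i * y i := by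
    intro i
    have h1 := abs_le.mp (hyi i)
    rcases lt_or_ge (e i) 0 with hi | hi
    · have hvi := hneg i hi
      have h2 : ‖inner ℂ v (b i)‖ = 1 := by
        rw [hvi, inner_self_eq_norm_sq_to_K, b.norm_eq_one]; simp
      have h3 : 3 / 4 ≤ ‖inner ℂ w (b i)‖ := by
        have := norm_sub_norm_le (inner ℂ v (b i)) (inner ℂ w (b i))
        rw [norm_sub_rev] at this
        linarith [hdiff i]
      rw [abs_of_neg hi]
      have h4 : y i ≤ -(1 / 16) := by nlinarith
      nlinarith
    · have h3 : ‖inner ℂ w (b i)‖ ≤ 1 / 4 := by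
        have := hdiff i
        rwa [hpos i hi, sub_zero] at this
      rw [abs_of_nonneg hi]
      have h4 : 1 / 16 ≤ y i := by nlinarith [norm_nonneg (inner ℂ w (b i))]
      nlinarith
  have hsum : ∑ i, e i * y i = (m : ℝ)⁻¹ * ∑ l, t w l * quadForm H (α l) := by
    simp only [quadForm_eq_sum_eigenvalues hH, hy, Finset.mul_sum]
    rw [Finset.sum_comm]
    refine Finset.sum_congr rfl fun l _ => Finset.sum_congr rfl fun i _ => ?_
    ring
  have h1 : hsNorm H / 16 ≤ (m : ℝ)⁻¹ * ∑ l, t w l * quadForm H (α l) := by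
    rw [← hsum]
    refine le_trans ?_ (Finset.sum_le_sum fun i _ => hterm i)
    rw [← Finset.sum_div]
    gcongr
    exact hsNorm_le_sum_abs_eigenvalues hH
  have h2 : ∑ l, t w l * quadForm H (α l) ≤ B * ∑ l, |quadForm H (α l)| := by
    rw [Finset.mul_sum]
    refine Finset.sum_le_sum fun l _ => ?_
    refine (le_abs_self _).trans ?_
    rw [abs_mul]
    exact mul_le_mul_of_nonneg_right (ht w hw l) (abs_nonneg _)
  rw [le_inv_mul_iff₀ hm0] at h1
  rw [div_mul_eq_mul_div, div_le_iff₀ (by positivity)]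
  linarith

end Certificates

section Concentration

variable {Ω : Type*} [MeasurableSpace Ω] {P : Measure Ω}

/-- Sub-exponential moment growth: `𝔼 |X|^N ≤ A a^N N!` for every `N ≥ 1`. -/
def SubExponentialMoments (X : Ω → ℝ) (P : Measure Ω) (A a : ℝ) : Prop :=
  Measurable X ∧ ∀ N : ℕ, 1 ≤ N →
    Integrable (fun ω => |X ω| ^ N) P ∧ ∫ ω, |X ω| ^ N ∂P ≤ A * a ^ N * (N ! : ℝ)

theorem hasSum_exp_sub_one_sub (x : ℝ) :
    HasSum (fun N : ℕ => x ^ (N + 2) / ((N + 2)! : ℝ)) (Real.exp x - 1 - x) := by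
  have h := NormedSpace.expSeries_div_hasSum_exp x
  rw [← Real.exp_eq_exp_ℝ] at h
  have h2 := (hasSum_nat_add_iff' 2).mpr h
  simpa [Finset.sum_range_succ, sub_sub] using h2

theorem exp_le_add_exp_abs (x : ℝ) : Real.exp x ≤ 1 + x + (Real.exp |x| - 1 - |x|) := by
  have h1 := hasSum_exp_sub_one_sub x
  have h2 := hasSum_exp_sub_one_sub |x|
  have := hasSum_le (fun N => by
    rw [← abs_pow]
    gcongr
    exact le_abs_self _) h1 h2
  linarith

theorem SubExponentialMoments.integral_exp_abs_le {X : Ω → ℝ} {A a s : ℝ} (hA : 0 ≤ A)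
    (ha : 0 ≤ a) (hX : SubExponentialMoments X P A a) (hs : |s| * a ≤ 1 / 2) :
    Integrable (fun ω => Real.exp |s * X ω| - 1 - |s * X ω|) P ∧
      ∫ ω, (Real.exp |s * X ω| - 1 - |s * X ω|) ∂P ≤ 2 * A * (s * a) ^ 2 := by
  have hmeas : Measurable fun ω => Real.exp |s * X ω| - 1 - |s * X ω| := by
    have := hX.1
    fun_prop
  have hnn : ∀ ω, 0 ≤ Real.exp |s * X ω| - 1 - |s * X ω| := fun ω => by
    linarith [Real.add_one_le_exp |s * X ω|]
  have hx0 : 0 ≤ |s| * a := by positivity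
  have hgeom : HasSum (fun N : ℕ => A * (|s| * a) ^ 2 * (|s| * a) ^ N)
      (A * (|s| * a) ^ 2 * (1 - |s| * a)⁻¹) :=
    (hasSum_geometric_of_lt_one hx0 (by linarith)).mul_left _
  have hlin : ∫⁻ ω, ENNReal.ofReal (Real.exp |s * X ω| - 1 - |s * X ω|) ∂P ≤
      ENNReal.ofReal (2 * A * (s * a) ^ 2) := by
    have h1 : ∀ ω, ENNReal.ofReal (Real.exp |s * X ω| - 1 - |s * X ω|) =
        ∑' N : ℕ, ENNReal.ofReal (|s * X ω| ^ (N + 2) / ((N + 2)! : ℝ)) := fun ω => by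
      have h := hasSum_exp_sub_one_sub |s * X ω|
      rw [← ENNReal.ofReal_tsum_of_nonneg (fun N => by positivity) h.summable, h.tsum_eq]
    simp only [h1]
    rw [lintegral_tsum fun N => by
      have := hX.1
      fun_prop]
    have h2 : ∀ N : ℕ, ∫⁻ ω, ENNReal.ofReal (|s * X ω| ^ (N + 2) / ((N + 2)! : ℝ)) ∂P ≤
        ENNReal.ofReal (A * (|s| * a) ^ 2 * (|s| * a) ^ N) := fun N => by
      obtain ⟨hi, hle⟩ := hX.2 (N + 2) (by omega)
      have h3 : ∀ ω, |s * X ω| ^ (N + 2) / ((N + 2)! : ℝ) =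
          |s| ^ (N + 2) / ((N + 2)! : ℝ) * |X ω| ^ (N + 2) := fun ω => by
        rw [abs_mul, mul_pow]; ring
      simp only [h3]
      rw [← ofReal_integral_eq_lintegral_ofReal (hi.const_mul _)
        (Filter.Eventually.of_forall fun ω => by positivity), integral_const_mul]
      refine ENNReal.ofReal_le_ofReal ?_
      calc _ ≤ |s| ^ (N + 2) / ((N + 2)! : ℝ) * (A * a ^ (N + 2) * ((N + 2)! : ℝ)) := by gcongr
        _ = _ := by
          have : ((N + 2)! : ℝ) ≠ 0 := by positivity
          field_simp
          ring
    refine (ENNReal.tsum_le_tsum h2).trans ?_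
    rw [← ENNReal.ofReal_tsum_of_nonneg (fun N => by positivity) hgeom.summable, hgeom.tsum_eq]
    refine ENNReal.ofReal_le_ofReal ?_
    have h4 : (1 - |s| * a)⁻¹ ≤ 2 := by
      rw [inv_le_comm₀ (by linarith) two_pos]; linarith
    calc A * (|s| * a) ^ 2 * (1 - |s| * a)⁻¹ ≤ A * (|s| * a) ^ 2 * 2 := by gcongr
      _ = _ := by rw [mul_pow, mul_pow, sq_abs]; ring
  refine ⟨⟨hmeas.aestronglyMeasurable, ?_⟩, ?_⟩
  · rw [hasFiniteIntegral_iff_ofReal (Filter.Eventually.of_forall hnn)]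
    exact hlin.trans_lt ENNReal.ofReal_lt_top
  · rw [integral_eq_lintegral_of_nonneg_ae (Filter.Eventually.of_forall hnn)
      hmeas.aestronglyMeasurable]
    exact ENNReal.toReal_le_of_le_ofReal (by positivity) hlin

theorem SubExponentialMoments.integrable {X : Ω → ℝ} {A a : ℝ}
    (hX : SubExponentialMoments X P A a) : Integrable X P := by
  have h := (hX.2 1 le_rfl).1
  simp only [pow_one] at h
  exact (integrable_norm_iff hX.1.aestronglyMeasurable).mp h

theorem SubExponentialMoments.integral_exp_le [IsProbabilityMeasure P] {X : Ω → ℝ} {A a s : ℝ}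
    (hA : 0 ≤ A) (ha : 0 ≤ a) (hX : SubExponentialMoments X P A a) (hs : |s| * a ≤ 1 / 2) :
    Integrable (fun ω => Real.exp (s * (X ω - ∫ ω, X ω ∂P))) P ∧
      ∫ ω, Real.exp (s * (X ω - ∫ ω, X ω ∂P)) ∂P ≤ Real.exp (2 * A * (s * a) ^ 2) := by
  obtain ⟨hi, hle⟩ := hX.integral_exp_abs_le hA ha hs
  have hdom : Integrable
      (fun ω => 1 + s * X ω + (Real.exp |s * X ω| - 1 - |s * X ω|)) P :=
    ((integrable_const _).add (hX.integrable.const_mul s)).add hi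
  have hexp : Integrable (fun ω => Real.exp (s * X ω)) P := by
    refine hdom.mono' ?_ (Filter.Eventually.of_forall fun ω => ?_)
    · have := hX.1
      exact (by fun_prop : Measurable fun ω => Real.exp (s * X ω)).aestronglyMeasurable
    · rw [Real.norm_eq_abs, Real.abs_exp]
      exact exp_le_add_exp_abs _
  have hbound : ∫ ω, Real.exp (s * X ω) ∂P ≤
      Real.exp (s * ∫ ω, X ω ∂P + 2 * A * (s * a) ^ 2) := by
    calc _ ≤ ∫ ω, (1 + s * X ω + (Real.exp |s * X ω| - 1 - |s * X ω|)) ∂P :=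
          integral_mono hexp hdom fun ω => exp_le_add_exp_abs _
      _ = 1 + s * ∫ ω, X ω ∂P + ∫ ω, (Real.exp |s * X ω| - 1 - |s * X ω|) ∂P := by
          have hsX := hX.integrable.const_mul s
          have h1 : Integrable (fun ω => 1 + s * X ω) P := (integrable_const _).add hsX
          rw [integral_add h1 hi, integral_add (integrable_const _) hsX, integral_const_mul]
          simp
      _ ≤ s * ∫ ω, X ω ∂P + 2 * A * (s * a) ^ 2 + 1 := by linarith
      _ ≤ _ := Real.add_one_le_exp _
  have hfun : ∀ ω, Real.exp (s * (X ω - ∫ ω, X ω ∂P)) =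
      Real.exp (-(s * ∫ ω, X ω ∂P)) * Real.exp (s * X ω) := fun ω => by
    rw [← Real.exp_add]; congr 1; ring
  simp only [hfun]
  refine ⟨hexp.const_mul _, ?_⟩
  rw [integral_const_mul]
  calc _ ≤ Real.exp (-(s * ∫ ω, X ω ∂P)) *
        Real.exp (s * ∫ ω, X ω ∂P + 2 * A * (s * a) ^ 2) := by gcongr
    _ = _ := by rw [← Real.exp_add]; congr 1; ring

theorem SubExponentialMoments.measureReal_le [IsProbabilityMeasure P] {X : Ω → ℝ} {A a δ s σ : ℝ}
    (hA : 0 ≤ A) (ha : 0 ≤ a) (hX : SubExponentialMoments X P A a) (hs0 : 0 ≤ s)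
    (hσ : |σ| = 1) (hs : s * a ≤ 1 / 2) (hs2 : 2 * A * (s * a) ^ 2 ≤ s * δ / 2) (m : ℕ) :
    (Measure.pi fun _ : Fin m => P).real
      {ω | m * δ ≤ σ * ∑ l, (X (ω l) - ∫ ω, X ω ∂P)} ≤ Real.exp (-(s * δ / 2) * m) := by
  have hσ2 : σ ^ 2 = 1 := by rw [← sq_abs, hσ, one_pow]
  obtain ⟨hi, hle⟩ := hX.integral_exp_le (s := s * σ) hA ha (by
    rwa [abs_mul, hσ, mul_one, abs_of_nonneg hs0])
  set e := ∫ ω, X ω ∂P with he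
  set f : Ω → ℝ := fun ω => Real.exp (s * σ * (X ω - e)) with hf
  have hmarkov := mul_meas_ge_le_integral_of_nonneg
    (μ := Measure.pi fun _ : Fin m => P) (f := fun ω => ∏ l, f (ω l))
    (Filter.Eventually.of_forall fun ω => Finset.prod_nonneg fun l _ => (Real.exp_pos _).le)
    (Integrable.fintype_prod fun _ => hi) (Real.exp (s * (m * δ)))
  rw [integral_fintype_prod_eq_pow, Fintype.card_fin] at hmarkov
  have hset : {ω : Fin m → Ω | m * δ ≤ σ * ∑ l, (X (ω l) - e)} ⊆
      {ω | Real.exp (s * (m * δ)) ≤ ∏ l, f (ω l)} := by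
    intro ω hω
    change Real.exp (s * (m * δ)) ≤ ∏ l, f (ω l)
    rw [← Real.exp_sum, ← Finset.mul_sum, mul_assoc]
    exact Real.exp_le_exp.mpr (mul_le_mul_of_nonneg_left hω hs0)
  have hpow : (∫ ω, f ω ∂P) ^ m ≤ Real.exp (s * δ / 2 * m) := by
    calc _ ≤ Real.exp (s * δ / 2) ^ m := by
          refine pow_le_pow_left₀ (integral_nonneg fun ω => (Real.exp_pos _).le) ?_ m
          refine hle.trans (Real.exp_le_exp.mpr (le_trans (le_of_eq ?_) hs2))
          rw [mul_pow, mul_pow, hσ2]; ring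
      _ = _ := by rw [← Real.exp_nat_mul, mul_comm]
  refine (measureReal_mono hset).trans ?_
  rw [← le_div_iff₀' (Real.exp_pos _)] at hmarkov
  refine hmarkov.trans ?_
  rw [div_le_iff₀ (Real.exp_pos _), ← Real.exp_add]
  refine hpow.trans (le_of_eq ?_)
  congr 1; ring

/-- Bernstein-type concentration of empirical means. -/
theorem exists_concentration_rate {A a δ : ℝ} (hA : 0 < A) (ha : 0 < a) (hδ : 0 < δ) :
    ∃ c : ℝ, 0 < c ∧ ∀ {Ω : Type} [MeasurableSpace Ω] (P : Measure Ω) [IsProbabilityMeasure P]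
      (X : Ω → ℝ), SubExponentialMoments X P A a → ∀ m : ℕ, 0 < m →
      (Measure.pi fun _ : Fin m => P).real
        {ω | δ ≤ |(m : ℝ)⁻¹ * ∑ l, X (ω l) - ∫ ω, X ω ∂P|} ≤ 2 * Real.exp (-c * m) := by
  set s := min (1 / (2 * a)) (δ / (4 * A * a ^ 2)) with hs
  have hs0 : 0 < s := by positivity
  have hs1 : s * a ≤ 1 / 2 := by
    have : s ≤ 1 / (2 * a) := min_le_left _ _
    rw [le_div_iff₀ (by positivity)] at this
    linarith
  have hs2 : 2 * A * (s * a) ^ 2 ≤ s * δ / 2 := by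
    have : s ≤ δ / (4 * A * a ^ 2) := min_le_right _ _
    rw [le_div_iff₀ (by positivity)] at this
    nlinarith
  refine ⟨s * δ / 2, by positivity, fun {Ω} _ P _ X hX m hm => ?_⟩
  have h1 := hX.measureReal_le (σ := 1) hA.le ha.le hs0.le (by simp) hs1 hs2 m
  have h2 := hX.measureReal_le (σ := -1) hA.le ha.le hs0.le (by simp) hs1 hs2 m
  have hm0 : (0 : ℝ) < m := by exact_mod_cast hm
  set e := ∫ ω, X ω ∂P with he
  refine (measureReal_mono (s₂ := {ω | m * δ ≤ 1 * ∑ l, (X (ω l) - e)} ∪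
    {ω | m * δ ≤ -1 * ∑ l, (X (ω l) - e)}) ?_).trans ((measureReal_union_le _ _).trans ?_)
  · intro ω hω
    have h3 : ∑ l, (X (ω l) - e) = m * ((m : ℝ)⁻¹ * ∑ l, X (ω l) - e) := by
      rw [mul_sub, mul_inv_cancel_left₀ hm0.ne', Finset.sum_sub_distrib]
      simp
    change m * δ ≤ 1 * ∑ l, (X (ω l) - e) ∨ m * δ ≤ -1 * ∑ l, (X (ω l) - e)
    rw [h3]
    rcases le_abs.mp (show δ ≤ |_| from hω) with h | h
    · left; nlinarith
    · right; nlinarith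
  · linarith

end Concentration

section Moments

variable {n : ℕ} {P : Measure (EuclideanSpace ℂ (Fin n))}

theorem SubGaussianTails.integral_le {CSG : ℝ} (hP : SubGaussianTails P CSG) (hCSG : 0 ≤ CSG)
    {u : EuclideanSpace ℂ (Fin n)} (hu : ‖u‖ ≤ 1) {N : ℕ} (hN : 1 ≤ N) :
    Integrable (fun α => ‖inner ℂ α u‖ ^ (2 * N)) P ∧
      ∫ α, ‖inner ℂ α u‖ ^ (2 * N) ∂P ≤ CSG * (N ! : ℝ) := by
  rcases eq_or_ne u 0 with rfl | hu0
  · have h0 : ∀ α : EuclideanSpace ℂ (Fin n),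
        ‖inner ℂ α (0 : EuclideanSpace ℂ (Fin n))‖ ^ (2 * N) = 0 := fun α => by
      rw [inner_zero_right, norm_zero, zero_pow (by omega)]
    simp only [h0, integral_zero]
    exact ⟨integrable_zero _ _ _, by positivity⟩
  · have hpos : 0 < ‖u‖ := norm_pos_iff.mpr hu0
    obtain ⟨h1, h2⟩ := hP (((‖u‖⁻¹ : ℝ) : ℂ) • u) (by
      rw [norm_smul, Complex.norm_real, norm_inv, norm_norm, inv_mul_cancel₀ hpos.ne']) N hN
    have h3 : ∀ α, ‖inner ℂ α u‖ ^ (2 * N) =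
        ‖u‖ ^ (2 * N) * ‖inner ℂ α (((‖u‖⁻¹ : ℝ) : ℂ) • u)‖ ^ (2 * N) := fun α => by
      rw [← mul_pow, inner_smul_right, norm_mul, Complex.norm_real, norm_inv, norm_norm,
        mul_inv_cancel_left₀ hpos.ne']
    simp only [h3]
    refine ⟨h1.const_mul _, ?_⟩
    rw [integral_const_mul]
    have h4 : ‖u‖ ^ (2 * N) ≤ 1 := pow_le_one₀ hpos.le hu
    have h5 : 0 ≤ ∫ α, ‖inner ℂ α (((‖u‖⁻¹ : ℝ) : ℂ) • u)‖ ^ (2 * N) ∂P :=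
      integral_nonneg fun α => by positivity
    exact (mul_le_of_le_one_left h5 h4).trans h2

theorem continuous_norm_inner_sq (u : EuclideanSpace ℂ (Fin n)) :
    Continuous fun α : EuclideanSpace ℂ (Fin n) => ‖inner ℂ α u‖ ^ 2 := by
  fun_prop

theorem continuous_quadForm_right {Z : Matrix (Fin n) (Fin n) ℂ} (hZ : Z.IsHermitian) :
    Continuous (quadForm Z) := by
  rw [funext (quadForm_eq_sum_eigenvalues hZ)]
  fun_prop

theorem SubGaussianTails.memLp_quadForm {CSG : ℝ} (hP : SubGaussianTails P CSG)
    {Z : Matrix (Fin n) (Fin n) ℂ} (hZ : Z.IsHermitian) : MemLp (quadForm Z) 2 P := by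
  rw [funext (quadForm_eq_sum_eigenvalues hZ)]
  refine memLp_finsetSum _ fun i _ => MemLp.const_mul ?_ _
  rw [memLp_two_iff_integrable_sq (continuous_norm_inner_sq _).aestronglyMeasurable]
  simp only [← pow_mul]
  exact (hP _ (hZ.eigenvectorBasis.norm_eq_one i) 2 (by norm_num)).1

theorem SubGaussianTails.integrable_quadForm_mul {CSG : ℝ} (hP : SubGaussianTails P CSG)
    {Z W : Matrix (Fin n) (Fin n) ℂ} (hZ : Z.IsHermitian) (hW : W.IsHermitian) :
    Integrable (fun α => quadForm Z α * quadForm W α) P :=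
  (hP.memLp_quadForm hZ).integrable_mul (hP.memLp_quadForm hW)

/-- The second-moment form `(Z, W) ↦ 𝔼 ⟨α|Z|α⟩ ⟨α|W|α⟩` on Hermitian matrices. -/
noncomputable def secondMoment {CSG : ℝ} (hP : SubGaussianTails P CSG) :
    selfAdjoint.submodule ℝ (Matrix (Fin n) (Fin n) ℂ) →ₗ[ℝ]
      Module.Dual ℝ (selfAdjoint.submodule ℝ (Matrix (Fin n) (Fin n) ℂ)) :=
  LinearMap.mk₂ ℝ (fun Z W => ∫ α, quadForm Z.1 α * quadForm W.1 α ∂P)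
    (fun Z Z' W => by
      rw [← integral_add (hP.integrable_quadForm_mul Z.2 W.2)
        (hP.integrable_quadForm_mul Z'.2 W.2)]
      simp only [Submodule.coe_add, quadForm_add, add_mul])
    (fun c Z W => by
      rw [smul_eq_mul, ← integral_const_mul]
      simp only [Submodule.coe_smul, quadForm_smul, mul_assoc])
    (fun Z W W' => by
      rw [← integral_add (hP.integrable_quadForm_mul Z.2 W.2)
        (hP.integrable_quadForm_mul Z.2 W'.2)]
      simp only [Submodule.coe_add, quadForm_add, mul_add])
    (fun c Z W => by
      rw [smul_eq_mul, ← integral_const_mul]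
      simp only [Submodule.coe_smul, quadForm_smul, mul_left_comm])

theorem eq_zero_of_hsNorm_eq_zero {Z : Matrix (Fin n) (Fin n) ℂ} (hZ : hsNorm Z = 0) : Z = 0 := by
  ext i j
  exact norm_le_zero_iff.mp ((norm_apply_le_hsNorm Z i j).trans hZ.le)

/-- Riesz representation of `W ↦ ⟨v|W|v⟩` with respect to the second-moment form. -/
theorem exists_quadForm_representer {CSI CSG : ℝ} (hCSI : 0 < CSI) (hSI : SubIsotropic P CSI)
    (hP : SubGaussianTails P CSG) {v : EuclideanSpace ℂ (Fin n)} (hv : ‖v‖ ≤ 1) :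
    ∃ G : Matrix (Fin n) (Fin n) ℂ, G.IsHermitian ∧
      (∀ W : Matrix (Fin n) (Fin n) ℂ, W.IsHermitian →
        ∫ α, quadForm G α * quadForm W α ∂P = quadForm W v) ∧
      ∫ α, quadForm G α ^ 2 ∂P ≤ 1 / CSI := by
  have hinj : Function.Injective (secondMoment hP) := by
    rw [← LinearMap.ker_eq_bot, LinearMap.ker_eq_bot']
    intro Z hZ
    have h1 : ∫ α, quadForm Z.1 α * quadForm Z.1 α ∂P = 0 := LinearMap.congr_fun hZ Z
    have h2 := hSI Z.1 Z.2
    simp only [sq (quadForm _ _), h1] at h2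
    have h3 : hsNorm Z.1 ^ 2 ≤ 0 := by nlinarith [sq_nonneg (hsNorm Z.1)]
    exact Subtype.ext (eq_zero_of_hsNorm_eq_zero (by nlinarith [hsNorm_nonneg Z.1]))
  have hsurj := (LinearMap.injective_iff_surjective_of_finrank_eq_finrank
    Subspace.dual_finrank_eq.symm).mp hinj
  obtain ⟨G, hG⟩ := hsurj
    { toFun := fun W => quadForm W.1 v
      map_add' := fun W W' => quadForm_add _ _ _
      map_smul' := fun c W => quadForm_smul _ _ _ }
  have hrep : ∀ W : Matrix (Fin n) (Fin n) ℂ, W.IsHermitian →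
      ∫ α, quadForm G.1 α * quadForm W α ∂P = quadForm W v :=
    fun W hW => LinearMap.congr_fun hG ⟨W, hW⟩
  refine ⟨G.1, G.2, hrep, ?_⟩
  have h1 := hSI G.1 G.2
  have h2 := hrep G.1 G.2
  simp only [← sq] at h2
  have h3 : quadForm G.1 v ≤ hsNorm G.1 := by
    refine (le_abs_self _).trans ((abs_quadForm_le _ _).trans ?_)
    exact mul_le_of_le_one_right (hsNorm_nonneg _) (pow_le_one₀ (norm_nonneg _) hv)
  have h4 := hsNorm_nonneg G.1
  rw [h2] at h1 ⊢
  rw [le_div_iff₀ hCSI]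
  rcases h4.eq_or_lt with h5 | h5
  · rw [← h5] at h3; nlinarith
  · have : CSI * hsNorm G.1 ≤ 1 := by
      by_contra! hcon
      nlinarith
    nlinarith

/-- Weights whose weighted covariance is `1 - 2 |v⟩⟨v|`, with bounded second moment. -/
theorem exists_weight [IsProbabilityMeasure P] {CI CSI CSG : ℝ} (hCI : 0 < CI) (hCSI : 0 < CSI)
    (hI : Isotropic P CI) (hSI : SubIsotropic P CSI) (hP : SubGaussianTails P CSG)
    (v : EuclideanSpace ℂ (Fin n)) (hv : ‖v‖ ≤ 1) :
    ∃ w : EuclideanSpace ℂ (Fin n) → ℝ, Measurable w ∧ Integrable (fun α => w α ^ 2) P ∧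
      ∫ α, w α ^ 2 ∂P ≤ 2 / CI ^ 2 + 8 / CSI ∧
      ∀ u, Integrable (fun α => w α * ‖inner ℂ α u‖ ^ 2) P ∧
        ∫ α, w α * ‖inner ℂ α u‖ ^ 2 ∂P = ‖u‖ ^ 2 - 2 * ‖inner ℂ v u‖ ^ 2 := by
  obtain ⟨G, hG, hrep, hsq⟩ := exists_quadForm_representer hCSI hSI hP hv
  have hGL := hP.memLp_quadForm hG
  have hwL : MemLp (fun α => 1 / CI - 2 * quadForm G α) 2 P :=
    (memLp_const _).sub (hGL.const_mul 2)
  refine ⟨fun α => 1 / CI - 2 * quadForm G α,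
    measurable_const.sub ((continuous_quadForm_right hG).measurable.const_mul 2),
    hwL.integrable_sq, ?_, fun u => ?_⟩
  · calc ∫ α, (1 / CI - 2 * quadForm G α) ^ 2 ∂P ≤
          ∫ α, (2 / CI ^ 2 + 8 * quadForm G α ^ 2) ∂P := by
          refine integral_mono hwL.integrable_sq
            ((integrable_const _).add (hGL.integrable_sq.const_mul 8)) fun α => ?_
          have : 2 / CI ^ 2 = 2 * (1 / CI) ^ 2 := by ring
          simp only [this]
          nlinarith [sq_nonneg (1 / CI + 2 * quadForm G α)]
      _ = 2 / CI ^ 2 + 8 * ∫ α, quadForm G α ^ 2 ∂P := by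
          rw [integral_add (integrable_const _) (hGL.integrable_sq.const_mul 8),
            integral_const_mul]
          simp
      _ ≤ 2 / CI ^ 2 + 8 * (1 / CSI) := by gcongr
      _ = _ := by ring
  · have hu := hP.memLp_quadForm (outer_isHermitian u)
    have h1 : Integrable (fun α => 1 / CI * ‖inner ℂ α u‖ ^ 2) P := by
      have := hu.integrable one_le_two
      rw [funext (quadForm_outer u)] at this
      exact this.const_mul _
    have h2 : Integrable (fun α => 2 * (quadForm G α * ‖inner ℂ α u‖ ^ 2)) P := by
      have := hP.integrable_quadForm_mul hG (outer_isHermitian u)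
      simp only [quadForm_outer] at this
      exact this.const_mul 2
    have h3 : ∀ α, (1 / CI - 2 * quadForm G α) * ‖inner ℂ α u‖ ^ 2 =
        1 / CI * ‖inner ℂ α u‖ ^ 2 - 2 * (quadForm G α * ‖inner ℂ α u‖ ^ 2) := fun α => by ring
    have h4 := hrep _ (outer_isHermitian u)
    simp only [quadForm_outer] at h4
    simp only [h3]
    refine ⟨h1.sub h2, ?_⟩
    rw [integral_sub h1 h2, integral_const_mul, integral_const_mul, hI, h4]
    field_simp

/-- Truncation of a real number to `[-B, B]`. -/
noncomputable def clip (B x : ℝ) : ℝ := max (-B) (min x B)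

theorem abs_clip_le {B : ℝ} (hB : 0 ≤ B) (x : ℝ) : |clip B x| ≤ B := by
  rw [abs_le]
  exact ⟨le_max_left _ _, max_le (by linarith) (min_le_right _ _)⟩

theorem abs_clip_sub_mul_le {R : ℝ} (hR : 0 < R) (w : ℝ) {b : ℝ} (hb : 0 ≤ b) :
    |clip (R ^ 2) w * b - w * b| ≤ (w ^ 2 + b ^ 4) / R := by
  rw [← sub_mul, abs_mul, abs_of_nonneg hb]
  have hR2 : 0 < R ^ 2 := by positivity
  by_cases hw : |w| ≤ R ^ 2
  · have : clip (R ^ 2) w = w := by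
      rw [clip, min_eq_left (abs_le.mp hw).2, max_eq_right (abs_le.mp hw).1]
    rw [this, sub_self, abs_zero, zero_mul]
    positivity
  · push Not at hw
    have h1 : |clip (R ^ 2) w - w| ≤ |w| := by
      unfold clip
      rcases lt_abs.mp hw with h | h
      · rw [min_eq_right h.le, max_eq_right (by linarith), abs_of_pos (a := w) (by linarith),
          abs_le]
        constructor <;> linarith
      · rw [min_eq_left (by linarith), max_eq_left (by linarith),
          abs_of_neg (a := w) (by linarith), abs_le]
        constructor <;> linarith
    rw [le_div_iff₀ hR, ← sq_abs w]
    have h2 : |clip (R ^ 2) w - w| * b * R ≤ |w| * (b * R) := by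
      rw [mul_assoc]
      exact mul_le_mul_of_nonneg_right h1 (by positivity)
    refine h2.trans ?_
    rcases le_total (b * R) |w| with h | h
    · have : 0 ≤ b ^ 4 := by positivity
      nlinarith [abs_nonneg w]
    · have hbR : R ≤ b := by
        by_contra! hcon
        nlinarith
      have h3 : |w| * (b * R) ≤ (b * R) ^ 2 := by nlinarith [mul_nonneg hb hR.le]
      have h4 : (b * R) ^ 2 ≤ (b * b) ^ 2 := by gcongr
      nlinarith [sq_nonneg |w|]

theorem subExponentialMoments_clip {CSG : ℝ} (hP : SubGaussianTails P CSG) (hCSG : 0 ≤ CSG)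
    {B : ℝ} (hB : 0 ≤ B) {w : EuclideanSpace ℂ (Fin n) → ℝ} (hw : Measurable w)
    {u : EuclideanSpace ℂ (Fin n)} (hu : ‖u‖ ≤ 1) :
    SubExponentialMoments (fun α => clip B (w α) * ‖inner ℂ α u‖ ^ 2) P CSG B := by
  have hmeas : Measurable fun α => clip B (w α) * ‖inner ℂ α u‖ ^ 2 :=
    (measurable_const.max (hw.min measurable_const)).mul (continuous_norm_inner_sq u).measurable
  refine ⟨hmeas, fun N hN => ?_⟩
  obtain ⟨h1, h2⟩ := hP.integral_le hCSG hu hN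
  have hle : ∀ α, |clip B (w α) * ‖inner ℂ α u‖ ^ 2| ^ N ≤
      B ^ N * ‖inner ℂ α u‖ ^ (2 * N) := fun α => by
    rw [abs_mul, mul_pow, abs_of_nonneg (by positivity : 0 ≤ ‖inner ℂ α u‖ ^ 2), ← pow_mul]
    gcongr
    exact abs_clip_le hB _
  have hint : Integrable (fun α => |clip B (w α) * ‖inner ℂ α u‖ ^ 2| ^ N) P := by
    refine (h1.const_mul (B ^ N)).mono' (hmeas.abs.pow_const N).aestronglyMeasurable
      (Filter.Eventually.of_forall fun α => ?_)
    rw [Real.norm_of_nonneg (by positivity)]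
    exact hle α
  refine ⟨hint, (integral_mono hint (h1.const_mul _) hle).trans ?_⟩
  rw [integral_const_mul]
  calc B ^ N * ∫ α, ‖inner ℂ α u‖ ^ (2 * N) ∂P ≤ B ^ N * (CSG * (N ! : ℝ)) := by gcongr
    _ = _ := by ring

theorem abs_integral_clip_sub_le {CSG D R : ℝ} (hP : SubGaussianTails P CSG) (hCSG : 0 ≤ CSG)
    (hR : 0 < R) {w : EuclideanSpace ℂ (Fin n) → ℝ} (hw : Measurable w)
    (hw2 : Integrable (fun α => w α ^ 2) P) (hD : ∫ α, w α ^ 2 ∂P ≤ D)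
    {u : EuclideanSpace ℂ (Fin n)} (hu : ‖u‖ ≤ 1)
    (hwu : Integrable (fun α => w α * ‖inner ℂ α u‖ ^ 2) P) :
    |∫ α, clip (R ^ 2) (w α) * ‖inner ℂ α u‖ ^ 2 ∂P - ∫ α, w α * ‖inner ℂ α u‖ ^ 2 ∂P| ≤
      (D + 24 * CSG) / R := by
  have hc := (subExponentialMoments_clip hP hCSG (sq_nonneg R) hw hu).integrable
  obtain ⟨h1, h2⟩ := hP.integral_le hCSG hu (N := 4) (by norm_num)
  have hdom : Integrable (fun α => (w α ^ 2 + ‖inner ℂ α u‖ ^ (2 * 4)) / R) P :=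
    (hw2.add h1).div_const R
  rw [← integral_sub hc hwu]
  calc _ ≤ ∫ α, |clip (R ^ 2) (w α) * ‖inner ℂ α u‖ ^ 2 - w α * ‖inner ℂ α u‖ ^ 2| ∂P :=
        abs_integral_le_integral_abs
    _ ≤ ∫ α, (w α ^ 2 + ‖inner ℂ α u‖ ^ (2 * 4)) / R ∂P := by
        refine integral_mono (hc.sub hwu).abs hdom fun α => ?_
        have := abs_clip_sub_mul_le hR (w α) (sq_nonneg ‖inner ℂ α u‖)
        rwa [← pow_mul] at this
    _ = (∫ α, w α ^ 2 ∂P + ∫ α, ‖inner ℂ α u‖ ^ (2 * 4) ∂P) / R := by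
        rw [integral_div, integral_add hw2 h1]
    _ ≤ _ := by
        have h4 : ((4 ! : ℕ) : ℝ) = 24 := by norm_num [Nat.factorial]
        rw [h4] at h2
        gcongr
        linarith

end Moments

section Probability

theorem one_sub_le_measureReal {Ω ι : Type*} [MeasurableSpace Ω] {μ : Measure Ω}
    [IsProbabilityMeasure μ] {s : Finset ι} {B : ι → Set Ω} {E : Set Ω} {p : ℝ}
    (hE : MeasurableSet E) (hB : ∀ i ∈ s, μ.real (B i) ≤ p) (hEB : Eᶜ ⊆ ⋃ i ∈ s, B i) :
    1 - s.card * p ≤ μ.real E := by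
  have h1 : μ.real Eᶜ ≤ s.card * p :=
    calc μ.real Eᶜ ≤ μ.real (⋃ i ∈ s, B i) := measureReal_mono hEB (measure_ne_top _ _)
      _ ≤ ∑ i ∈ s, μ.real (B i) := measureReal_biUnion_finset_le _ _
      _ ≤ ∑ _i ∈ s, p := Finset.sum_le_sum hB
      _ = _ := by simp
  rw [probReal_compl_eq_one_sub hE] at h1
  linarith

/-- With overwhelming probability, the measurement map separates positive semidefinite matrices
from rank-one matrices. -/
theorem exists_event_separatesRankOne {CI CSI CSG : ℝ} (hCI : 0 < CI) (hCSI : 0 < CSI)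
    (hCSG : 0 < CSG) : ∃ C B γ K : ℝ, 0 < C ∧ 0 < B ∧ 0 < γ ∧ 0 < K ∧
      ∀ n m : ℕ, 1 ≤ n → C * (n : ℝ) ≤ (m : ℝ) →
        ∀ P : Measure (EuclideanSpace ℂ (Fin n)), IsProbabilityMeasure P →
          Isotropic P CI → SubIsotropic P CSI → SubGaussianTails P CSG →
          0 < m ∧ ∃ E : Set (Fin m → EuclideanSpace ℂ (Fin n)), MeasurableSet E ∧
            ENNReal.ofReal (1 - K * Real.exp (-γ * (m : ℝ))) ≤
              Measure.pi (fun _ : Fin m => P) E ∧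
            ∀ α ∈ E, SeparatesRankOne α (m / (16 * B)) := by
  set D := 2 / CI ^ 2 + 8 / CSI with hD
  have hD0 : 0 < D := by positivity
  set R := 128 * (D + 24 * CSG) with hR
  have hR0 : 0 < R := by positivity
  have hbias : (D + 24 * CSG) / R = 1 / 128 := by
    rw [hR]; field_simp
  obtain ⟨c, hc, hconc⟩ := exists_concentration_rate hCSG (by positivity : 0 < R ^ 2)
    (by norm_num : (0 : ℝ) < 1 / 128)
  have hlog : 0 < Real.log 6561 := Real.log_pos (by norm_num)
  refine ⟨2 * Real.log 6561 / c, R ^ 2, c / 2, 2, by positivity, by positivity, by positivity,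
    two_pos, fun n m hn hm P hprob hI hSI hP => ?_⟩
  have hn0 : (0 : ℝ) < n := by exact_mod_cast hn
  have hm0 : 0 < m := by
    have : (0 : ℝ) < m := lt_of_lt_of_le (by positivity) hm
    exact_mod_cast this
  refine ⟨hm0, ?_⟩
  obtain ⟨N, hN, hcard⟩ := exists_isUnitBallNet n
  choose! w hwm hw2 hwD hwu using exists_weight hCI hCSI hI hSI hP
  set X : EuclideanSpace ℂ (Fin n) × EuclideanSpace ℂ (Fin n) → EuclideanSpace ℂ (Fin n) → ℝ :=
    fun vu α => clip (R ^ 2) (w vu.1 α) * ‖inner ℂ α vu.2‖ ^ 2 with hX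
  have hXs : ∀ vu ∈ N ×ˢ N, SubExponentialMoments (X vu) P CSG (R ^ 2) := fun vu h =>
    subExponentialMoments_clip hP hCSG.le (sq_nonneg R) (hwm _ (hN.1 _ (Finset.mem_product.mp h).1))
      (hN.1 _ (Finset.mem_product.mp h).2)
  set F : EuclideanSpace ℂ (Fin n) × EuclideanSpace ℂ (Fin n) →
      Set (Fin m → EuclideanSpace ℂ (Fin n)) :=
    fun vu => {α | 1 / 128 ≤ |(m : ℝ)⁻¹ * ∑ l, X vu (α l) - ∫ β, X vu β ∂P|} with hF
  have hFmeas : ∀ vu ∈ N ×ˢ N, MeasurableSet (F vu) := fun vu h => by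
    have := (hXs vu h).1
    exact measurableSet_le measurable_const (by fun_prop)
  set E := (⋃ vu ∈ N ×ˢ N, F vu)ᶜ with hE
  have hEmeas : MeasurableSet E := (Finset.measurableSet_biUnion _ hFmeas).compl
  refine ⟨E, hEmeas, ?_, fun α hα => ?_⟩
  · have h1 := one_sub_le_measureReal (μ := Measure.pi fun _ : Fin m => P) hEmeas
      (fun vu h => hconc P (X vu) (hXs vu h) m hm0) (by rw [hE, compl_compl])
    rw [Finset.card_product] at h1
    refine ENNReal.ofReal_le_of_le_toReal (le_trans ?_ h1)
    have h2 : ((N.card * N.card : ℕ) : ℝ) ≤ Real.exp (c / 2 * m) := by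
      calc ((N.card * N.card : ℕ) : ℝ) ≤ ((81 ^ n * 81 ^ n : ℕ) : ℝ) := by
            exact_mod_cast Nat.mul_le_mul hcard hcard
        _ = (6561 : ℝ) ^ n := by rw [← mul_pow]; norm_num
        _ = Real.exp (n * Real.log 6561) := by
            rw [Real.exp_nat_mul, Real.exp_log (by norm_num)]
        _ ≤ _ := by
            rw [div_mul_eq_mul_div, div_le_iff₀ hc] at hm
            exact Real.exp_le_exp.mpr (by linarith)
    have h3 : ((N.card * N.card : ℕ) : ℝ) * (2 * Real.exp (-c * m)) ≤
        2 * Real.exp (-(c / 2) * m) := by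
      calc _ ≤ Real.exp (c / 2 * m) * (2 * Real.exp (-c * m)) := by gcongr
        _ = 2 * Real.exp (-(c / 2) * m) := by
            rw [mul_left_comm, ← Real.exp_add]; congr 2; ring
    linarith
  · refine separatesRankOne_of_certificateForm_le hN (t := fun v l => clip (R ^ 2) (w v (α l)))
      (by positivity) hm0 (fun v _ l => abs_clip_le (sq_nonneg R) _) fun v hv u hu => ?_
    have h1 : |(m : ℝ)⁻¹ * ∑ l, X (v, u) (α l) - ∫ β, X (v, u) β ∂P| < 1 / 128 := by
      by_contra! hcon
      exact hα (Set.mem_biUnion (Finset.mem_product.mpr ⟨hv, hu⟩) hcon)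
    have h2 := abs_integral_clip_sub_le hP hCSG.le hR0 (hwm v (hN.1 v hv)) (hw2 v (hN.1 v hv))
      (hwD v (hN.1 v hv)) (hN.1 u hu) (hwu v (hN.1 v hv) u).1
    rw [hbias, (hwu v (hN.1 v hv) u).2] at h2
    refine (abs_sub_le _ (∫ β, X (v, u) β ∂P) _).trans ?_
    linarith

end Probability

end TransferMatrix

theorem mainTheorem2 (CI CSI CSG : ℝ) (hCI : 0 < CI) (hCSI : 0 < CSI) (hCSG : 0 < CSG) :
    ∃ C C' γ K : ℝ, 0 < C ∧ 0 < C' ∧ 0 < γ ∧ 0 < K ∧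
      ∀ n m : ℕ, 1 ≤ n → C * (n : ℝ) ≤ (m : ℝ) →
        ∀ P : Measure (EuclideanSpace ℂ (Fin n)), IsProbabilityMeasure P →
          TransferMatrix.Isotropic P CI →
          TransferMatrix.SubIsotropic P CSI →
          TransferMatrix.SubGaussianTails P CSG →
          ∃ E : Set (Fin m → EuclideanSpace ℂ (Fin n)), MeasurableSet E ∧
            ENNReal.ofReal (1 - K * Real.exp (-γ * (m : ℝ))) ≤
              Measure.pi (fun _ : Fin m => P) E ∧
            ∀ α ∈ E, ∀ (M : Matrix (Fin n) (Fin n) ℂ) (ε : Fin n → Fin m → ℝ),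
              (∃ Ms : Matrix (Fin n) (Fin n) ℂ, TransferMatrix.IsReconstruction α M ε Ms) ∧
              (0 < TransferMatrix.minRowNorm M →
                ∀ Ms : Matrix (Fin n) (Fin n) ℂ, TransferMatrix.IsReconstruction α M ε Ms →
                  ∃ μ : Fin n → ℂ, (∀ j, ‖μ j‖ = 1) ∧
                    TransferMatrix.hsNorm (Ms - Matrix.diagonal μ * M) ≤
                      C' * ((n : ℝ) * TransferMatrix.totalNoise ε /
                        ((m : ℝ) * TransferMatrix.minRowNorm M))) := by

  obtain ⟨C, B, γ, K, hC, hB, hγ, hK, hmain⟩ :=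
    TransferMatrix.exists_event_separatesRankOne hCI hCSI hCSG
  refine ⟨C, 160 * B, γ, K, hC, by positivity, hγ, hK, fun n m hn hm P hprob hI hSI hP => ?_⟩
  obtain ⟨hm0, E, hE, hPE, hsep⟩ := hmain n m hn hm P hprob hI hSI hP
  have hm0' : (0 : ℝ) < m := by exact_mod_cast hm0
  have hc : (0 : ℝ) < m / (16 * B) := by positivity
  refine ⟨E, hE, hPE, fun α hα M ε =>
    ⟨(hsep α hα).exists_isReconstruction hc hn M ε, fun hM Ms hMs => ?_⟩⟩
  obtain ⟨μ, hμ, hle⟩ := (hsep α hα).hsNorm_reconstruction_sub_le hc hM hMs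
  refine ⟨μ, hμ, hle.trans ?_⟩
  have hn1 : (1 : ℝ) ≤ n := by exact_mod_cast hn
  have ht : 0 ≤ TransferMatrix.totalNoise ε := Real.sqrt_nonneg _
  calc 10 / (m / (16 * B)) * (TransferMatrix.totalNoise ε / TransferMatrix.minRowNorm M)
      = 160 * B * (1 * TransferMatrix.totalNoise ε / (m * TransferMatrix.minRowNorm M)) := by
        field_simp
        ring
    _ ≤ _ := by gcongr
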